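/- Let $1\le p<\infty$. A (real) Banach lattice $E$ is an abstract $L_p$-space if $\|x+y\|^p=\|x\|^p+\|y\|^p$ whenever $x,y\in E$ and $x\wedge y=0$. A sublattice of $E$ is a norm-closed linear subspace closed under $\wedge$ and $\vee$, and $C^\perp=\{f\in E: |f|\wedge|g|=0\text{ for all }g\in C\}$. A measure space $(X,\mathcal A,\mu)$ is decomposable, with witness $(X_i)_{i\in I}$, if $(X_i)_{i\in I}$ is a partition of $X$ into measurable sets of finite measure such that, for every $A\subseteq X$, $A\in\mathcal A$ iff $A\cap X_i\in\mathcal A$ for all $i\in I$, and in that case $\mu(A)=\sum_{i\in I}\mu(A\cap X_i)$. Write $(Y,\mathcal B,\mu)\subset(X,\mathcal A,\mu)$ if $Y\subseteq X$, $\mathcal B$ is a $\sigma$-algebra of subsets of $Y$ with $\mathcal B\subseteq\mathcal A$, the measure on $\mathcal B$ is the restriction of $\mu$, and there are a witness $(X_i)_{i\in I}$ for the decomposability of $(X,\mathcal A,\mu)$ and a set $J\subseteq I$ such that $(X_i)_{i\in J}$ is a witness for the decomposability of $(Y,\mathcal B,\mu)$. In this case $L_p(Y,\mathcal B,\mu)$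 is regarded as a subset of $L_p(X,\mathcal A,\mu)$ through extension by zero outside $Y$, and for $f\in L_p(X,\mathcal A,\mu)$ the conditional expectation $\mathbb E(f|\mathcal B)$ is the unique $g\in L_p(Y,\mathcal B,\mu)$ such that $\int_A g\,d\mu=\int_A f\,d\mu$ for every $A\in\mathcal B$ over which $f$ is integrable (in particular for every $A\in\mathcal B$ of finite measure; if $p=1$, for every $A\in\mathcal B$). **Proposition 2.7.** Let $E$ be an abstract $L_p$ Banach lattice and let $C$ be any sublattice of $E$. There is a unique linear operator $T:E\to C$ such that $T$ is a contractive ($\|Tf\|\le\|f\|$ for all $f\in E$), positive ($Tf\ge0$ whenever $f\ge0$) projection ($Tf=f$ for all $f\in C$) and $T(f)=0$ for every $f\in C^\perp$. Moreover, if $(Y,\mathcal B,\mu)\subset(X,\mathcal A,\mu)$ are any measure spaces as above and $\Phi$ is any isomorphism of Banach lattices (linear, surjective, isometric and order-preserving in both directions) from $L_p(X,\mathcal A,\mu)$ onto $E$ that maps $L_p(Y,\mathcal B,\mu)$ exactly onto $C$, then for every $f\in E$ the conditional expectation $\mathbb E(\Phi^{-1}(f)|\mathcal B)$ exists and is unique,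 and $$T(f)=\Phi\bigl(\mathbb E(\Phi^{-1}(f)|\mathcal B)\bigr).$$ -/

import Mathlib

open MeasureTheory
open scoped ENNReal

/-! ### Abstract `L_p` Banach lattices, sublattices and disjoint complements -/

section BanachLattice

variable {E : Type*} [NormedAddCommGroup E] [NormedSpace ℝ E] [Lattice E]

/-- A Banach lattice `E` is an abstract `L_p`-space if
`‖x + y‖ ^ p = ‖x‖ ^ p + ‖y‖ ^ p` whenever `x ⊓ y = 0`. (The Banach lattice axioms themselves are
the type class assumptions `NormedSpace ℝ E`, `CompleteSpace E`, `IsOrderedAddMonoid E`,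
`IsOrderedModule ℝ E` and `HasSolidNorm E`.) -/
def IsAbstractLp (p : ℝ≥0∞) (E : Type*) [NormedAddCommGroup E] [Lattice E] : Prop :=
  ∀ x y : E, x ⊓ y = 0 → ‖x + y‖ ^ p.toReal = ‖x‖ ^ p.toReal + ‖y‖ ^ p.toReal

/-- A sublattice of a Banach lattice, in the Banach space sense: a norm-closed linear subspace that
is closed under the lattice operations. -/
structure IsClosedSublattice (C : Submodule ℝ E) : Prop where
  isClosed : IsClosed (C : Set E)
  sup_mem : ∀ f ∈ C, ∀ g ∈ C, f ⊔ g ∈ C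
  inf_mem : ∀ f ∈ C, ∀ g ∈ C, f ⊓ g ∈ C

/-- The band `B^⊥` orthogonal to a subset `B` of a Banach lattice. -/
def disjointComplement (B : Set E) : Set E :=
  {f | ∀ g ∈ B, |f| ⊓ |g| = 0}

/-- `T : E → C` is a contractive, positive linear projection onto `C` that vanishes on `C^⊥`. -/
structure IsContractivePositiveProjection (C : Submodule ℝ E) (T : E →ₗ[ℝ] C) : Prop where
  contractive : ∀ f : E, ‖T f‖ ≤ ‖f‖
  positive : ∀ f : E, 0 ≤ f → 0 ≤ (T f : E)
  proj : ∀ f : C, T (f : E) = f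
  vanish : ∀ f ∈ disjointComplement (C : Set E), T f = 0

end BanachLattice

/-! ### Decomposable measure spaces and measure subspaces -/

/-- The partition `P` of `X` into nonempty measurable sets of finite measure witnesses that
`(X, μ)` is decomposable (strictly localizable). -/
structure IsDecompositionWitness {X : Type*} {U : MeasurableSpace X} (μ : Measure X)
    (P : Set (Set X)) : Prop where
  isPartition : Setoid.IsPartition P
  measurableSet : ∀ S ∈ P, MeasurableSet S
  measure_lt_top : ∀ S ∈ P, μ S < ∞
  measurableSet_iff : ∀ A : Set X, MeasurableSet A ↔ ∀ S ∈ P, MeasurableSet (A ∩ S)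
  measure_eq : ∀ A : Set X, MeasurableSet A → μ A = ∑' S : P, μ (A ∩ S)

/-- `(Y, V, ν) ⊂ (X, U, μ)` for a subset `Y` of `X` and a σ-algebra `V` of subsets of `Y`: every
member of `V` is a member of `U`, the measures agree on `V`, and some witness for the
decomposability of `(X, U, μ)` has a subfamily that witnesses the decomposability of `(Y, V, ν)`.
In particular both measure spaces are decomposable. Subsets of `Y` are sets in the subtype `Y`, and
`V` need not be the σ-algebra that `U` induces on `Y`. -/
structure IsMeasureSubspace {X : Type*} [U : MeasurableSpace X] (μ : Measure X) (Y : Set X)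
    {V : MeasurableSpace Y} (ν : Measure[V] Y) : Prop where
  measurableSet_image : ∀ A : Set Y, MeasurableSet[V] A → MeasurableSet[U] (Subtype.val '' A)
  measure_eq : ∀ A : Set Y, MeasurableSet[V] A → ν A = μ (Subtype.val '' A)
  exists_witness : ∃ (P : Set (Set X)) (Q : Set (Set Y)), IsDecompositionWitness μ P ∧
    IsDecompositionWitness ν Q ∧ ∀ S ∈ Q, Subtype.val '' S ∈ P

namespace IsMeasureSubspace

variable {X : Type*} [U : MeasurableSpace X] {μ : Measure X} {Y : Set X} {V : MeasurableSpace Y}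
  {ν : Measure[V] Y}

theorem le_subtype (h : IsMeasureSubspace μ Y ν) : V ≤ Subtype.instMeasurableSpace := by
  intro A hA
  exact ⟨Subtype.val '' A, h.measurableSet_image A hA,
    Set.preimage_image_eq A Subtype.val_injective⟩

theorem measurableSet (h : IsMeasureSubspace μ Y ν) : MeasurableSet Y := by
  have := h.measurableSet_image Set.univ (@MeasurableSet.univ _ V)
  simpa using this

theorem trim_comap (h : IsMeasureSubspace μ Y ν) :
    (@Measure.comap Y X Subtype.instMeasurableSpace U Subtype.val μ).trim h.le_subtype = ν := by
  refine @Measure.ext _ V _ _ fun A hA => ?_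
  rw [trim_measurableSet_eq _ hA, h.measure_eq A hA,
    (MeasurableEmbedding.subtype_coe h.measurableSet).comap_apply]

/-- The extension by zero of a function in `L_p(Y, V, ν)` is in `L_p(X, U, μ)`. -/
theorem memLp_extend (h : IsMeasureSubspace μ Y ν) {p : ℝ≥0∞} (g : Lp ℝ p ν) :
    MemLp (Function.extend Subtype.val (g : Y → ℝ) 0) p μ := by
  have hg := Lp.stronglyMeasurable g
  have he := MeasurableEmbedding.subtype_coe h.measurableSet
  have hm : StronglyMeasurable (Function.extend Subtype.val (g : Y → ℝ) (0 : X → ℝ)) :=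
    he.stronglyMeasurable_extend (hg.mono h.le_subtype) stronglyMeasurable_zero
  refine ⟨hm.aestronglyMeasurable, ?_⟩
  have hi : Function.extend Subtype.val (g : Y → ℝ) (0 : X → ℝ)
      = Y.indicator (Function.extend Subtype.val (g : Y → ℝ) (0 : X → ℝ)) := by
    symm
    rw [Set.indicator_eq_self]
    intro x hx
    by_contra hxY
    refine hx ?_
    rw [Function.extend_apply']
    · rfl
    · rintro ⟨y, rfl⟩
      exact hxY y.2
  rw [hi, eLpNorm_indicator_eq_eLpNorm_restrict h.measurableSet,
    ← map_comap_subtype_coe h.measurableSet, he.eLpNorm_map_measure,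
    Function.extend_comp Subtype.val_injective, ← eLpNorm_trim h.le_subtype hg, h.trim_comap]
  exact Lp.eLpNorm_lt_top g

/-- The inclusion of `L_p(Y, V, ν)` into `L_p(X, U, μ)`: extension by zero outside `Y`. -/
noncomputable def inclLp (h : IsMeasureSubspace μ Y ν) {p : ℝ≥0∞} (g : Lp ℝ p ν) : Lp ℝ p μ :=
  (h.memLp_extend g).toLp _

end IsMeasureSubspace

/-- `g ∈ L_p(Y, V, ν)` is the conditional expectation of `f ∈ L_p(X, U, μ)` with respect to
`(Y, V, ν)`: `∫_A g = ∫_A f` for every `A ∈ V` over which `f` has an integral. (These are all `A`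
in `V` if `p = 1`; for any `p` they include all `A` in `V` of finite measure.) -/
def IsCondExpLp {X : Type*} [U : MeasurableSpace X] {μ : Measure X} {Y : Set X}
    {V : MeasurableSpace Y} {ν : Measure[V] Y} {p : ℝ≥0∞} (f : Lp ℝ p μ) (g : Lp ℝ p ν) : Prop :=
  ∀ A : Set Y, MeasurableSet[V] A → IntegrableOn (f : X → ℝ) (Subtype.val '' A) μ →
    IntegrableOn (g : Y → ℝ) A ν ∧ ∫ y in A, g y ∂ν = ∫ x in Subtype.val '' A, f x ∂μ

set_option linter.unusedSectionVars false

/-! In function spaces `T` is a conditional expectation; the proof constructs it inside `E` without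
representing `E` as an `L_p`. Write r = p. The substitute for integration over a set of finite
measure is a functional `F` that touches the convex function ‖·‖^r / r at some e ≥ 0
(`IsSupporting`); Hahn–Banach supplies it. Disjoint additivity and a derivative at 0 force F c =
‖c‖^r at every component c of e (`IsSupporting.apply_component`): e plays the role of an indicator
function and ‖c‖^r that of the measure of c. By Freudenthal's theorem (`mem_of_components`) the
components of e determine a supporting functional on the whole band of e.

Existence. For 0 ≤ e ∈ C, each finite partition of e into components in C yields an averaging
operator, which is positive and, by Jensen's inequality, contractive. For 0 ≤ f ≤ e the square means
of the averages increase under refinement and stay bounded, so the averages converge as in the L_2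
martingale theorem; density extends this to all f (`cauchySeq_average`). The limit is the
expectation onto the part of C in the band of e (`exists_expectation_band`). Summing these over a
maximal disjoint family in C gives `T`.

Uniqueness. If `T` is any such projection and `F` supports at 0 ≤ e ∈ C, then F ∘ T supports at e
too, because `T` is contractive and fixes e; hence F ∘ T = F on the band of e. Off the band
positivity and the vanishing on C^⊥ take over, and F ∘ T = F everywhere if `F` vanishes on e^⊥
(`IsSupporting.apply_projection`). Taking e = (Tf - Sf)⁺ for two projections gives ‖e‖^r = F(Tf -
Sf) = 0.

Representation. In `L_p`, integration over a set A of finite measure supports at the indicator of A,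
so the same invariance says that `T` preserves integrals over such A in the subspace. Sets of
infinite measure follow by exhaustion, with T|f| as dominating function (`isCondExpLp_of_finite`).
-/

namespace AbstractLp

open Filter Topology

/-! ### Disjointness in vector lattices -/

section Order

variable {E : Type*} [AddCommGroup E] [Lattice E] [IsOrderedAddMonoid E]

lemma add_inf_le {a b c : E} (ha : 0 ≤ a) (hb : 0 ≤ b) (hc : 0 ≤ c) :
    (a + b) ⊓ c ≤ a ⊓ c + b ⊓ c := by
  rw [inf_add, add_inf, add_inf]
  refine le_inf (le_inf inf_le_left ?_) (le_inf ?_ ?_)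
  · exact inf_le_right.trans (le_add_of_nonneg_left ha)
  · exact inf_le_right.trans (le_add_of_nonneg_right hb)
  · exact inf_le_right.trans (le_add_of_nonneg_left hc)

/-- Disjointness of two elements of a vector lattice. -/
def Perp (a b : E) : Prop := |a| ⊓ |b| = 0

lemma perp_iff_le {a b : E} : Perp a b ↔ |a| ⊓ |b| ≤ 0 :=
  ⟨fun h => h.le, fun h => le_antisymm h (le_inf (abs_nonneg _) (abs_nonneg _))⟩

lemma Perp.symm {a b : E} (h : Perp a b) : Perp b a := by
  rwa [Perp, inf_comm]

lemma Perp.mono {a a' b b' : E} (h : Perp a b) (ha : |a'| ≤ |a|) (hb : |b'| ≤ |b|) :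
    Perp a' b' :=
  perp_iff_le.2 ((inf_le_inf ha hb).trans h.le)

lemma Perp.mono_left {a a' b : E} (h : Perp a b) (ha : |a'| ≤ |a|) : Perp a' b :=
  h.mono ha le_rfl

lemma Perp.mono_right {a b b' : E} (h : Perp a b) (hb : |b'| ≤ |b|) : Perp a b' :=
  h.mono le_rfl hb

lemma Perp.of_inf_eq_zero {a b : E} (h : a ⊓ b = 0) : Perp a b := by
  have ha : 0 ≤ a := h ▸ inf_le_left
  have hb : 0 ≤ b := h ▸ inf_le_right
  rwa [Perp, abs_of_nonneg ha, abs_of_nonneg hb]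

lemma Perp.inf_eq_zero {a b : E} (h : Perp a b) (ha : 0 ≤ a) (hb : 0 ≤ b) : a ⊓ b = 0 := by
  rwa [Perp, abs_of_nonneg ha, abs_of_nonneg hb] at h

lemma Perp.add_left {a b c : E} (ha : Perp a c) (hb : Perp b c) : Perp (a + b) c := by
  refine perp_iff_le.2 ((inf_le_inf_right _ (abs_add_le a b)).trans ?_)
  refine (add_inf_le (abs_nonneg _) (abs_nonneg _) (abs_nonneg _)).trans ?_
  rw [show |a| ⊓ |c| = 0 from ha, show |b| ⊓ |c| = 0 from hb, add_zero]

lemma Perp.neg_left {a c : E} (ha : Perp a c) : Perp (-a) c := by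
  rwa [Perp, abs_neg]

lemma Perp.add_right {a b c : E} (hb : Perp a b) (hc : Perp a c) : Perp a (b + c) :=
  (hb.symm.add_left hc.symm).symm

lemma Perp.sub_left {a b c : E} (ha : Perp a c) (hb : Perp b c) : Perp (a - b) c := by
  rw [sub_eq_add_neg]; exact ha.add_left hb.neg_left

lemma perp_zero_right (a : E) : Perp a 0 := by
  rw [Perp, abs_zero]; exact inf_eq_right.2 (abs_nonneg a)

lemma perp_zero_left (a : E) : Perp 0 a := (perp_zero_right a).symm

lemma perp_self_iff {a : E} : Perp a a ↔ a = 0 := by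
  refine ⟨fun h => ?_, fun h => h ▸ perp_zero_right 0⟩
  have h1 : |a| = 0 := by rw [Perp, inf_idem] at h; exact h
  refine le_antisymm (h1 ▸ le_abs_self a) ?_
  have := h1 ▸ neg_le_abs a
  simpa using this

lemma perp_abs_left {a b : E} : Perp |a| b ↔ Perp a b := by
  rw [Perp, Perp, abs_abs]

lemma perp_posPart_negPart (a : E) : Perp a⁺ a⁻ := .of_inf_eq_zero (posPart_inf_negPart_eq_zero a)

lemma abs_posPart_le (a : E) : |a⁺| ≤ |a| := by
  rw [abs_of_nonneg (posPart_nonneg a), ← posPart_add_negPart a]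
  exact le_add_of_nonneg_right (negPart_nonneg a)

lemma abs_negPart_le (a : E) : |a⁻| ≤ |a| := by
  rw [abs_of_nonneg (negPart_nonneg a), ← posPart_add_negPart a]
  exact le_add_of_nonneg_left (posPart_nonneg a)

lemma Perp.sum_left {ι : Type*} {s : Finset ι} {x : ι → E} {c : E}
    (h : ∀ i ∈ s, Perp (x i) c) : Perp (∑ i ∈ s, x i) c := by
  classical
  induction s using Finset.induction_on with
  | empty => simpa using perp_zero_left c
  | insert i s hi ih =>
    rw [Finset.sum_insert hi]
    exact (h i (Finset.mem_insert_self _ _)).add_left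
      (ih fun j hj => h j (Finset.mem_insert_of_mem hj))

lemma abs_le_of_nonneg_le {a b : E} (ha : 0 ≤ a) (h : a ≤ b) : |a| ≤ |b| := by
  rw [abs_of_nonneg ha, abs_of_nonneg (ha.trans h)]; exact h

/-- The sum |a| + |b| of disjoint elements is their supremum, and in a bound |a| ≤ |a + b| + |b| the
summand disjoint from |a| can be dropped. -/
lemma abs_add_of_perp {a b : E} (h : Perp a b) : |a + b| = |a| + |b| := by
  refine le_antisymm (abs_add_le a b) ?_
  have h1 : |a| + |b| = |a| ⊔ |b| := by
    have := inf_add_sup |a| |b|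
    rw [show |a| ⊓ |b| = 0 from h, zero_add] at this
    exact this.symm
  have h2 : |a| ≤ |a + b| + |b| := by
    have := abs_add_le (a + b) (-b)
    simpa using this
  have h3 : |b| ≤ |a + b| + |a| := by
    have := abs_add_le (a + b) (-a)
    simpa using this
  have key : ∀ {x y z : E}, 0 ≤ x → 0 ≤ y → 0 ≤ z → x ⊓ y = 0 → x ≤ z + y → x ≤ z := by
    intro x y z hx hy hz hxy hle
    have : (z + y) ⊓ x ≤ z ⊓ x + y ⊓ x := add_inf_le hz hy hx
    rw [inf_eq_right.2 hle, inf_comm y x, hxy, add_zero] at this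
    exact this.trans inf_le_left
  rw [h1]
  refine sup_le (key (abs_nonneg _) (abs_nonneg _) (abs_nonneg _) h h2)
    (key (abs_nonneg _) (abs_nonneg _) (abs_nonneg _) h.symm h3)

end Order

/-! ### Disjoint complements and bands -/

section Module

variable {E : Type*} [AddCommGroup E] [Lattice E] [IsOrderedAddMonoid E] [Module ℝ E]
  [IsOrderedModule ℝ E]

lemma smul_inf_smul {t : ℝ} (ht : 0 ≤ t) (a b : E) : (t • a) ⊓ (t • b) = t • (a ⊓ b) := by
  rcases ht.eq_or_lt with rfl | ht
  · simp
  refine le_antisymm ?_ (le_inf (smul_le_smul_of_nonneg_left inf_le_left ht.le)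
    (smul_le_smul_of_nonneg_left inf_le_right ht.le))
  have key : t⁻¹ • ((t • a) ⊓ (t • b)) ≤ a ⊓ b := by
    refine le_inf ?_ ?_
    · have := smul_le_smul_of_nonneg_left (inf_le_left : (t • a) ⊓ (t • b) ≤ t • a)
        (inv_nonneg.2 ht.le)
      rwa [inv_smul_smul₀ ht.ne'] at this
    · have := smul_le_smul_of_nonneg_left (inf_le_right : (t • a) ⊓ (t • b) ≤ t • b)
        (inv_nonneg.2 ht.le)
      rwa [inv_smul_smul₀ ht.ne'] at this
  have := smul_le_smul_of_nonneg_left key ht.le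
  rwa [smul_inv_smul₀ ht.ne'] at this

lemma abs_smul_le (t : ℝ) (a : E) : |t • a| ≤ |t| • |a| := by
  rcases le_total 0 t with ht | ht
  · rw [abs_of_nonneg ht]
    refine abs_le'.2 ⟨smul_le_smul_of_nonneg_left (le_abs_self a) ht, ?_⟩
    rw [← smul_neg]
    exact smul_le_smul_of_nonneg_left (neg_le_abs a) ht
  · rw [abs_of_nonpos ht]
    have ht' : 0 ≤ -t := neg_nonneg.2 ht
    refine abs_le'.2 ⟨?_, ?_⟩
    · rw [← neg_smul_neg t a]
      exact smul_le_smul_of_nonneg_left (neg_le_abs a) ht'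
    · rw [← neg_smul]
      exact smul_le_smul_of_nonneg_left (le_abs_self a) ht'

lemma Perp.smul_left {a b : E} (h : Perp a b) (t : ℝ) : Perp (t • a) b := by
  refine perp_iff_le.2 ?_
  have hs : (1 : ℝ) ≤ |t| + 1 := by linarith [abs_nonneg t]
  have h1 : |t • a| ≤ (|t| + 1) • |a| :=
    (abs_smul_le t a).trans (smul_le_smul_of_nonneg_right (by linarith) (abs_nonneg a))
  have h2 : |b| ≤ (|t| + 1) • |b| := by
    simpa using smul_le_smul_of_nonneg_right hs (abs_nonneg b)
  refine (inf_le_inf h1 h2).trans ?_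
  rw [smul_inf_smul (by linarith), show |a| ⊓ |b| = 0 from h, smul_zero]

lemma Perp.smul_right {a b : E} (h : Perp a b) (t : ℝ) : Perp a (t • b) :=
  (h.symm.smul_left t).symm

/-- The disjoint complement of a set, as a linear subspace. -/
def polar (B : Set E) : Submodule ℝ E where
  carrier := {f | ∀ g ∈ B, Perp f g}
  add_mem' ha hb g hg := (ha g hg).add_left (hb g hg)
  zero_mem' g _ := perp_zero_left g
  smul_mem' t _ ha g hg := (ha g hg).smul_left t

lemma mem_polar {B : Set E} {f : E} : f ∈ polar B ↔ ∀ g ∈ B, Perp f g := Iff.rfl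

lemma mem_polar_singleton {u f : E} : f ∈ polar {u} ↔ Perp f u := by simp [mem_polar]

/-- The band generated by an element, as its double disjoint complement. -/
def band (u : E) : Submodule ℝ E := polar (polar {u} : Set E)

lemma mem_band {u f : E} : f ∈ band u ↔ ∀ g, Perp g u → Perp f g := by
  simp [band, mem_polar (B := (polar {u} : Set E)), mem_polar_singleton]

lemma self_mem_band (u : E) : u ∈ band u := mem_band.2 fun _ hg => hg.symm

lemma band_mono_abs {u f g : E} (hf : f ∈ band u) (h : |g| ≤ |f|) : g ∈ band u :=
  mem_band.2 fun k hk => (mem_band.1 hf k hk).mono_left h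

lemma mem_band_of_abs_le {u f : E} (h : |f| ≤ |u|) : f ∈ band u :=
  band_mono_abs (self_mem_band u) h

lemma band_le_band {u v : E} (h : u ∈ band v) : band u ≤ band v := fun _ hf =>
  mem_band.2 fun g hg => mem_band.1 hf g (mem_band.1 h g hg).symm

end Module

section Normed

variable {E : Type*} [NormedAddCommGroup E] [NormedSpace ℝ E] [Lattice E] [IsOrderedAddMonoid E]
  [IsOrderedModule ℝ E] [HasSolidNorm E]

lemma continuous_latticeAbs : Continuous fun x : E => |x| :=
  continuous_id.sup continuous_neg

lemma isClosed_polar (B : Set E) : IsClosed (polar B : Set E) := by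
  have : (polar B : Set E) = ⋂ g ∈ B, {f : E | |f| ⊓ |g| = 0} := by
    ext f; simp [mem_polar, Perp]
  rw [this]
  exact isClosed_biInter fun g _ =>
    isClosed_eq (continuous_latticeAbs.inf continuous_const) continuous_const

lemma isClosed_band (u : E) : IsClosed (band u : Set E) := isClosed_polar _

lemma norm_le_norm_of_nonneg_le {a b : E} (ha : 0 ≤ a) (h : a ≤ b) : ‖a‖ ≤ ‖b‖ :=
  norm_le_norm_of_abs_le_abs (abs_le_of_nonneg_le ha h)

end Normed

/-- The norm is `r`-additive on disjoint positive elements. -/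
def DisjointlyAdditive (r : ℝ) (E : Type*) [NormedAddCommGroup E] [Lattice E] : Prop :=
  ∀ x y : E, x ⊓ y = 0 → ‖x + y‖ ^ r = ‖x‖ ^ r + ‖y‖ ^ r

/-! ### Additivity of the r-th power of the norm over disjoint sums -/

section Additive

variable {E : Type*} [NormedAddCommGroup E] [NormedSpace ℝ E] [Lattice E] [IsOrderedAddMonoid E]
  [IsOrderedModule ℝ E] [HasSolidNorm E] {r : ℝ}

lemma norm_add_rpow (hE : DisjointlyAdditive r E) {x y : E} (h : Perp x y) :
    ‖x + y‖ ^ r = ‖x‖ ^ r + ‖y‖ ^ r := by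
  rw [← norm_abs_eq_norm (x + y), abs_add_of_perp h, hE _ _ h, norm_abs_eq_norm, norm_abs_eq_norm]

lemma norm_sum_rpow (hr : 1 ≤ r) (hE : DisjointlyAdditive r E) {ι : Type*} (s : Finset ι)
    (x : ι → E) (h : ∀ i ∈ s, ∀ j ∈ s, i ≠ j → Perp (x i) (x j)) :
    ‖∑ i ∈ s, x i‖ ^ r = ∑ i ∈ s, ‖x i‖ ^ r := by
  classical
  induction s using Finset.induction_on with
  | empty => simp [Real.zero_rpow (by linarith : r ≠ 0)]
  | insert i s hi ih =>
    rw [Finset.sum_insert hi, Finset.sum_insert hi, norm_add_rpow hE, ih]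
    · exact fun a ha b hb => h a (Finset.mem_insert_of_mem ha) b (Finset.mem_insert_of_mem hb)
    · refine (Perp.sum_left fun j hj => ?_).symm
      exact h j (Finset.mem_insert_of_mem hj) i (Finset.mem_insert_self _ _)
        (fun e => hi (e ▸ hj))

end Additive

section Order

variable {E : Type*} [AddCommGroup E] [Lattice E] [IsOrderedAddMonoid E]

lemma add_le_of_perp {a b c : E} (h : Perp a b) (ha : 0 ≤ a) (hb : 0 ≤ b) (hac : a ≤ c)
    (hbc : b ≤ c) : a + b ≤ c := by
  have := inf_add_sup a b
  rw [h.inf_eq_zero ha hb, zero_add] at this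
  rw [← this]
  exact sup_le hac hbc

lemma sum_le_of_perp {ι : Type*} (s : Finset ι) (x : ι → E) {c : E} (hc : 0 ≤ c)
    (h : ∀ i ∈ s, ∀ j ∈ s, i ≠ j → Perp (x i) (x j)) (h0 : ∀ i ∈ s, 0 ≤ x i)
    (hle : ∀ i ∈ s, x i ≤ c) : ∑ i ∈ s, x i ≤ c := by
  classical
  induction s using Finset.induction_on with
  | empty => simpa using hc
  | insert i s hi ih =>
    rw [Finset.sum_insert hi]
    have hm : ∀ j ∈ s, j ∈ insert i s := fun j hj => Finset.mem_insert_of_mem hj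
    refine add_le_of_perp (Perp.sum_left fun j hj => ?_).symm
      (h0 i (Finset.mem_insert_self _ _)) (Finset.sum_nonneg fun j hj => h0 j (hm j hj))
      (hle i (Finset.mem_insert_self _ _))
      (ih (fun a ha b hb => h a (hm a ha) b (hm b hb)) (fun j hj => h0 j (hm j hj))
        fun j hj => hle j (hm j hj))
    exact h j (hm j hj) i (Finset.mem_insert_self _ _) (fun e => hi (e ▸ hj))

lemma sub_inf_eq_posPart (f g : E) : f - f ⊓ g = (f - g)⁺ := by
  rw [inf_eq_sub_posPart_sub]; abel

end Order

/-! ### Band projections -/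

section Normed

variable {E : Type*} [NormedAddCommGroup E] [NormedSpace ℝ E] [Lattice E] [IsOrderedAddMonoid E]
  [IsOrderedModule ℝ E] [HasSolidNorm E] {r : ℝ}

lemma monotone_inf_smul {u : E} (f : E) (hu : 0 ≤ u) :
    Monotone fun n : ℕ => f ⊓ ((n : ℝ) • u) := fun _ _ h =>
  inf_le_inf_left _ (smul_le_smul_of_nonneg_right (by exact_mod_cast h) hu)

/-- Otherwise there are gaps x_b - x_a of norm at least ε with a arbitrarily large. Such a gap lies
below (f - a u)⁺, and after subtracting δ f also below (b u - δ f)⁺. If each a is much larger than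
the preceding b, the reduced gaps are pairwise disjoint, lie below f and have norm at least ε / 2,
so r-additivity makes ‖f‖ infinite. -/
lemma cauchySeq_inf_smul (hr : 1 ≤ r) (hE : DisjointlyAdditive r E) {f u : E} (hf : 0 ≤ f)
    (hu : 0 ≤ u) : CauchySeq fun n : ℕ => f ⊓ ((n : ℝ) • u) := by
  set x : ℕ → E := fun n => f ⊓ ((n : ℝ) • u) with hx
  have hmono : Monotone x := monotone_inf_smul f hu
  have hx0 : ∀ n, 0 ≤ x n := fun n => le_inf hf (smul_nonneg n.cast_nonneg hu)
  rw [Metric.cauchySeq_iff']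
  by_contra! hcon
  obtain ⟨ε, hε, hcon⟩ := hcon
  choose b hb hbε using hcon
  have hf1 : 0 < ‖f‖ + 1 := by positivity
  -- Chosen so that ‖δ f‖ ≤ ε / 2: the reduced gap keeps half of its norm.
  set δ : ℝ := ε / (2 * (‖f‖ + 1)) with hδ
  have hδ0 : 0 < δ := by positivity
  have hδf : δ * ‖f‖ ≤ ε / 2 := by
    rw [hδ, div_mul_eq_mul_div, div_le_div_iff₀ (by positivity) (by positivity)]
    nlinarith
  obtain ⟨D, hD⟩ := exists_nat_ge (1 / δ + 1)
  have hD1 : (1 : ℝ) ≤ D := le_trans (by have : 0 < 1 / δ := by positivity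
                                         linarith) hD
  have hDδ : 1 ≤ δ * D := by
    have : 1 / δ ≤ D := by linarith
    rwa [div_le_iff₀ hδ0, mul_comm] at this
  have hD1' : 1 ≤ D := by exact_mod_cast hD1
  -- Since δ D ≥ 1, this growth gives b (a j) ≤ δ a k whenever j < k.
  obtain ⟨a, ha_succ⟩ : ∃ a : ℕ → ℕ, ∀ k, a (k + 1) = D * b (a k) :=
    ⟨fun k => Nat.rec 0 (fun _ ak => D * b ak) k, fun k => rfl⟩
  have ha_mono : Monotone a := monotone_nat_of_le_succ fun k => by
    rw [ha_succ]
    exact (hb (a k)).trans (Nat.le_mul_of_pos_left _ hD1')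
  set w : ℕ → E := fun k => (x (b (a k)) - x (a k) - δ • f)⁺ with hw
  have hw0 : ∀ k, 0 ≤ w k := fun k => posPart_nonneg _
  have hδf0 : 0 ≤ δ • f := smul_nonneg hδ0.le hf
  have hwf : ∀ k, w k ≤ f := fun k => by
    refine sup_le ?_ hf
    refine (sub_le_self _ hδf0).trans ((sub_le_self _ (hx0 _)).trans inf_le_left)
  have hw1 : ∀ k, w k ≤ (((b (a k) : ℕ) : ℝ) • u - δ • f)⁺ := fun k =>
    posPart_mono (sub_le_sub_right ((sub_le_self _ (hx0 _)).trans inf_le_right) _)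
  have hw2 : ∀ k, w k ≤ (f - (Nat.cast (a k) : ℝ) • u)⁺ := fun k => by
    rw [← sub_inf_eq_posPart]
    refine sup_le ?_ (sub_nonneg.2 inf_le_left)
    exact (sub_le_self _ hδf0).trans (sub_le_sub_right (inf_le_left : x (b (a k)) ≤ f) _)
  have hdisj : ∀ j k, j < k → Perp (w j) (w k) := by
    intro j k hjk
    -- This bounds `w j` by a multiple of a negative part whose positive part bounds `w k`.
    have h1 : (((b (a j) : ℕ) : ℝ) • u - δ • f)⁺ ≤ δ • (f - (Nat.cast (a k) : ℝ) • u)⁻ := by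
      refine sup_le ?_ (smul_nonneg hδ0.le (negPart_nonneg _))
      have h2 : ((b (a j) : ℕ) : ℝ) ≤ δ * (Nat.cast (a k) : ℝ) := by
        have h3 : D * b (a j) ≤ a k := by rw [← ha_succ]; exact ha_mono hjk
        have h4 : (D : ℝ) * (b (a j) : ℝ) ≤ a k := by exact_mod_cast h3
        have h5 : (0 : ℝ) ≤ b (a j) := Nat.cast_nonneg _
        nlinarith
      have h3 : -(f - (Nat.cast (a k) : ℝ) • u) ≤ (f - (Nat.cast (a k) : ℝ) • u)⁻ := neg_le_negPart _
      have h4 := smul_le_smul_of_nonneg_left h3 hδ0.le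
      refine le_trans ?_ h4
      rw [neg_sub, smul_sub, smul_smul]
      exact sub_le_sub_right (smul_le_smul_of_nonneg_right h2 hu) _
    have h2 : Perp (δ • (f - (Nat.cast (a k) : ℝ) • u)⁻) (f - (Nat.cast (a k) : ℝ) • u)⁺ :=
      (perp_posPart_negPart _).symm.smul_left δ
    exact h2.mono (abs_le_of_nonneg_le (hw0 j) ((hw1 j).trans h1))
      (abs_le_of_nonneg_le (hw0 k) (hw2 k))
  have hdisj' : ∀ j k, j ≠ k → Perp (w j) (w k) := fun j k h =>
    (lt_or_gt_of_ne h).elim (hdisj j k) fun h => (hdisj k j h).symm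
  have hwε : ∀ k, ε / 2 ≤ ‖w k‖ := by
    intro k
    have h1 : x (b (a k)) - x (a k) ≤ w k + δ • f := by
      rw [← sub_le_iff_le_add]; exact le_posPart _
    have h2 : ‖x (b (a k)) - x (a k)‖ ≤ ‖w k + δ • f‖ :=
      norm_le_norm_of_nonneg_le (sub_nonneg.2 (hmono (hb _))) h1
    have h3 : ε ≤ ‖x (b (a k)) - x (a k)‖ := by rw [← dist_eq_norm]; exact hbε _
    have h4 := norm_add_le (w k) (δ • f)
    rw [norm_smul, Real.norm_of_nonneg hδ0.le] at h4
    linarith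
  have hbound : ∀ K : ℕ, K * (ε / 2) ^ r ≤ ‖f‖ ^ r := by
    intro K
    have h1 := norm_sum_rpow hr hE (Finset.range K) w fun i _ j _ => hdisj' i j
    have h2 : ∑ k ∈ Finset.range K, w k ≤ f :=
      sum_le_of_perp _ _ hf (fun i _ j _ => hdisj' i j) (fun i _ => hw0 i) fun i _ => hwf i
    have h3 : ‖∑ k ∈ Finset.range K, w k‖ ^ r ≤ ‖f‖ ^ r :=
      Real.rpow_le_rpow (norm_nonneg _)
        (norm_le_norm_of_nonneg_le (Finset.sum_nonneg fun i _ => hw0 i) h2) (by linarith)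
    have h4 : ∑ _k ∈ Finset.range K, (ε / 2) ^ r ≤ ∑ k ∈ Finset.range K, ‖w k‖ ^ r :=
      Finset.sum_le_sum fun k _ => Real.rpow_le_rpow (by positivity) (hwε k) (by linarith)
    rw [Finset.sum_const, Finset.card_range, nsmul_eq_mul] at h4
    linarith
  have hpos : 0 < (ε / 2) ^ r := Real.rpow_pos_of_pos (by positivity) r
  obtain ⟨K, hK⟩ := exists_nat_gt (‖f‖ ^ r / (ε / 2) ^ r)
  rw [div_lt_iff₀ hpos] at hK
  linarith [hbound K]

variable [CompleteSpace E]

/-- The component of `f ≥ 0` in the band of `u ≥ 0`, as the limit of `f ⊓ n • u`. -/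
lemma exists_tendsto_inf_smul (hr : 1 ≤ r) (hE : DisjointlyAdditive r E) {f u : E} (hf : 0 ≤ f)
    (hu : 0 ≤ u) : ∃ g, Tendsto (fun n : ℕ => f ⊓ ((n : ℝ) • u)) atTop (𝓝 g) ∧ 0 ≤ g ∧ g ≤ f ∧
      g ∈ band u ∧ f - g ∈ polar {u} := by
  obtain ⟨g, hg⟩ := cauchySeq_tendsto_of_complete (cauchySeq_inf_smul hr hE hf hu)
  have hmono := monotone_inf_smul f hu
  have hle : ∀ n : ℕ, f ⊓ ((n : ℝ) • u) ≤ g := fun n => hmono.ge_of_tendsto hg n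
  have hgf : g ≤ f := le_of_tendsto' hg fun n => inf_le_left
  have hg0 : 0 ≤ g := ge_of_tendsto' hg fun n => le_inf hf (smul_nonneg n.cast_nonneg hu)
  refine ⟨g, hg, hg0, hgf, ?_, ?_⟩
  · refine (isClosed_band u).mem_of_tendsto hg (Eventually.of_forall fun n => ?_)
    refine band_mono_abs ((band u).smul_mem (n : ℝ) (self_mem_band u)) ?_
    exact abs_le_of_nonneg_le (le_inf hf (smul_nonneg n.cast_nonneg hu)) inf_le_right
  · rw [mem_polar_singleton, perp_iff_le, abs_of_nonneg (sub_nonneg.2 hgf), abs_of_nonneg hu]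
    set h := (f - g) ⊓ u with hh
    -- Adding h to the n-th term stays below the next term, hence below g; in the limit g + h ≤ g.
    have h1 : ∀ n : ℕ, f ⊓ ((n : ℝ) • u) + h ≤ g := fun n => by
      refine le_trans (le_inf ?_ ?_) (hle (n + 1))
      · have := add_le_add (hle n) (inf_le_left : h ≤ f - g)
        simpa using this
      · push_cast
        rw [add_smul, one_smul]
        exact add_le_add inf_le_right inf_le_right
    have h2 : g + h ≤ g := le_of_tendsto' (hg.add_const h) h1
    simpa using h2

lemma isCompl_band_polar (hr : 1 ≤ r) (hE : DisjointlyAdditive r E) {u : E} (hu : 0 ≤ u) :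
    IsCompl (band u) (polar {u}) := by
  refine IsCompl.of_eq ?_ ?_
  · rw [Submodule.eq_bot_iff]
    rintro f ⟨h1, h2⟩
    exact perp_self_iff.1 (mem_band.1 h1 f (mem_polar_singleton.1 h2))
  · rw [eq_top_iff]
    intro f _
    have key : ∀ f : E, 0 ≤ f → f ∈ band u ⊔ polar {u} := fun f hf => by
      obtain ⟨g, -, -, -, h1, h2⟩ := exists_tendsto_inf_smul hr hE hf hu
      rw [← add_sub_cancel g f]
      exact Submodule.add_mem_sup h1 h2
    rw [← posPart_sub_negPart f]
    exact Submodule.sub_mem _ (key _ (posPart_nonneg f)) (key _ (negPart_nonneg f))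

open Classical in
/-- The projection onto the band generated by `u` along its disjoint complement; zero if these are
not complementary. -/
noncomputable def bandProj (u : E) : E →ₗ[ℝ] E :=
  if h : IsCompl (band u) (polar {u}) then Submodule.projection (band u) (polar {u}) h else 0

section

variable (hr : 1 ≤ r) (hE : DisjointlyAdditive r E) {u v f g : E}

include hr hE

lemma bandProj_mem (hu : 0 ≤ u) (f : E) : bandProj u f ∈ band u := by
  rw [bandProj, dif_pos (isCompl_band_polar hr hE hu)]
  exact Submodule.projection_apply_mem _ _

lemma sub_bandProj_mem (hu : 0 ≤ u) (f : E) : f - bandProj u f ∈ polar {u} := by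
  rw [bandProj, dif_pos (isCompl_band_polar hr hE hu)]
  exact Submodule.sub_projection_mem _ _

lemma bandProj_eq (hu : 0 ≤ u) (h1 : g ∈ band u) (h2 : f - g ∈ polar {u}) : bandProj u f = g := by
  have hc := isCompl_band_polar hr hE hu
  have h3 : bandProj u f - g ∈ band u := sub_mem (bandProj_mem hr hE hu f) h1
  have h4 : bandProj u f - g ∈ polar {u} := by
    have := sub_mem h2 (sub_bandProj_mem hr hE hu f)
    simpa using this
  exact sub_eq_zero.1 ((Submodule.disjoint_def.1 hc.disjoint) _ h3 h4)

lemma bandProj_of_mem (hu : 0 ≤ u) (h : f ∈ band u) : bandProj u f = f :=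
  bandProj_eq hr hE hu h (by simp)

lemma bandProj_self (hu : 0 ≤ u) : bandProj u u = u := bandProj_of_mem hr hE hu (self_mem_band u)

lemma bandProj_of_perp (hu : 0 ≤ u) (h : Perp f u) : bandProj u f = 0 :=
  bandProj_eq hr hE hu (zero_mem _) (by simpa [mem_polar_singleton] using h)

lemma tendsto_bandProj (hu : 0 ≤ u) (hf : 0 ≤ f) :
    Tendsto (fun n : ℕ => f ⊓ ((n : ℝ) • u)) atTop (𝓝 (bandProj u f)) := by
  obtain ⟨g, hg, -, -, h1, h2⟩ := exists_tendsto_inf_smul hr hE hf hu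
  rwa [bandProj_eq hr hE hu h1 h2]

lemma bandProj_nonneg (hu : 0 ≤ u) (hf : 0 ≤ f) : 0 ≤ bandProj u f := by
  obtain ⟨g, -, h0, -, h1, h2⟩ := exists_tendsto_inf_smul hr hE hf hu
  rwa [bandProj_eq hr hE hu h1 h2]

lemma bandProj_le_self (hu : 0 ≤ u) (hf : 0 ≤ f) : bandProj u f ≤ f := by
  obtain ⟨g, -, -, h0, h1, h2⟩ := exists_tendsto_inf_smul hr hE hf hu
  rwa [bandProj_eq hr hE hu h1 h2]

lemma bandProj_mono (hu : 0 ≤ u) (hfg : f ≤ g) : bandProj u f ≤ bandProj u g := by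
  have := bandProj_nonneg hr hE hu (sub_nonneg.2 hfg)
  rwa [map_sub, sub_nonneg] at this

lemma abs_bandProj_le (hu : 0 ≤ u) (f : E) : |bandProj u f| ≤ bandProj u |f| :=
  abs_le'.2 ⟨bandProj_mono hr hE hu (le_abs_self f), by
    rw [← map_neg]; exact bandProj_mono hr hE hu (neg_le_abs f)⟩

lemma abs_bandProj_le_abs (hu : 0 ≤ u) (f : E) : |bandProj u f| ≤ |f| :=
  (abs_bandProj_le hr hE hu f).trans (bandProj_le_self hr hE hu (abs_nonneg f))

lemma norm_bandProj_le (hu : 0 ≤ u) (f : E) : ‖bandProj u f‖ ≤ ‖f‖ :=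
  norm_le_norm_of_abs_le_abs (abs_bandProj_le_abs hr hE hu f)

lemma perp_bandProj_bandProj (hu : 0 ≤ u) (hv : 0 ≤ v) (h : Perp u v) (f g : E) :
    Perp (bandProj u f) (bandProj v g) := by
  have h1 : Perp (bandProj u f) v := mem_band.1 (bandProj_mem hr hE hu f) v h.symm
  exact (mem_band.1 (bandProj_mem hr hE hv g) _ h1).symm

lemma bandProj_add (hu : 0 ≤ u) (hv : 0 ≤ v) (h : Perp u v) (f : E) :
    bandProj (u + v) f = bandProj u f + bandProj v f := by
  have huv : 0 ≤ u + v := add_nonneg hu hv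
  refine bandProj_eq hr hE huv (add_mem ?_ ?_) ?_
  · exact band_le_band (mem_band_of_abs_le (abs_le_of_nonneg_le hu (le_add_of_nonneg_right hv)))
      (bandProj_mem hr hE hu f)
  · exact band_le_band (mem_band_of_abs_le (abs_le_of_nonneg_le hv (le_add_of_nonneg_left hu)))
      (bandProj_mem hr hE hv f)
  · rw [mem_polar_singleton]
    have h1 : Perp (bandProj u f) v := mem_band.1 (bandProj_mem hr hE hu f) v h.symm
    have h2 : Perp (bandProj v f) u := mem_band.1 (bandProj_mem hr hE hv f) u h
    have h3 := mem_polar_singleton.1 (sub_bandProj_mem hr hE hu f)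
    have h4 := mem_polar_singleton.1 (sub_bandProj_mem hr hE hv f)
    refine Perp.add_right ?_ ?_
    · rw [← sub_sub]; exact h3.sub_left h2
    · rw [add_comm (bandProj u f), ← sub_sub]; exact h4.sub_left h1

lemma bandProj_sum {ι : Type*} (s : Finset ι) (x : ι → E) (h0 : ∀ i ∈ s, 0 ≤ x i)
    (h : ∀ i ∈ s, ∀ j ∈ s, i ≠ j → Perp (x i) (x j)) (f : E) :
    bandProj (∑ i ∈ s, x i) f = ∑ i ∈ s, bandProj (x i) f := by
  classical
  induction s using Finset.induction_on with
  | empty => simpa using bandProj_of_perp hr hE le_rfl (perp_zero_right f)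
  | insert i s hi ih =>
    have hm : ∀ j ∈ s, j ∈ insert i s := fun j hj => Finset.mem_insert_of_mem hj
    rw [Finset.sum_insert hi, Finset.sum_insert hi, bandProj_add hr hE
      (h0 i (Finset.mem_insert_self _ _)) (Finset.sum_nonneg fun j hj => h0 j (hm j hj)),
      ih (fun j hj => h0 j (hm j hj)) (fun a ha b hb => h a (hm a ha) b (hm b hb))]
    exact (Perp.sum_left fun j hj => h j (hm j hj) i (Finset.mem_insert_self _ _)
      (fun e => hi (e ▸ hj))).symm

lemma norm_sum_bandProj_rpow_le {ι : Type*} (s : Finset ι) (x : ι → E) (h0 : ∀ i ∈ s, 0 ≤ x i)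
    (h : ∀ i ∈ s, ∀ j ∈ s, i ≠ j → Perp (x i) (x j)) (f : E) :
    ∑ i ∈ s, ‖bandProj (x i) f‖ ^ r ≤ ‖f‖ ^ r := by
  rw [← norm_sum_rpow hr hE s (fun i => bandProj (x i) f)
    (fun i hi j hj hij => perp_bandProj_bandProj hr hE (h0 i hi) (h0 j hj) (h i hi j hj hij) f f),
    ← bandProj_sum hr hE s x h0 h]
  exact Real.rpow_le_rpow (norm_nonneg _)
    (norm_bandProj_le hr hE (Finset.sum_nonneg h0) f) (by linarith)

/-- Band projections of elements of a closed sublattice stay in the sublattice. -/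
lemma bandProj_mem_sublattice {C : Submodule ℝ E} (hC : IsClosedSublattice C) (huC : u ∈ C)
    (hu : 0 ≤ u) (hf : f ∈ C) : bandProj u f ∈ C := by
  have key : ∀ f ∈ C, 0 ≤ f → bandProj u f ∈ C := fun f hfC hf =>
    hC.isClosed.mem_of_tendsto (tendsto_bandProj hr hE hu hf)
      (Eventually.of_forall fun n => hC.inf_mem _ hfC _ (C.smul_mem _ huC))
  rw [← posPart_sub_negPart f, map_sub]
  exact sub_mem (key _ (hC.sup_mem _ hf _ (zero_mem C)) (posPart_nonneg f))
    (key _ (hC.sup_mem _ (neg_mem hf) _ (zero_mem C)) (negPart_nonneg f))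

end

end Normed

/-- Bernoulli's inequality at s = y / x - 1, multiplied by x^r: the graph of t^r lies above its
tangent at x. -/
lemma mul_rpow_sub_one_mul_le {r x y : ℝ} (hr : 1 ≤ r) (hx : 0 < x) (hy : 0 ≤ y) :
    r * (x ^ (r - 1) * y) ≤ (r - 1) * x ^ r + y ^ r := by
  have h1 := one_add_mul_self_le_rpow_one_add (s := y / x - 1)
    (by have : 0 ≤ y / x := by positivity
        linarith) hr
  rw [add_sub_cancel, Real.div_rpow hy hx.le, le_div_iff₀ (Real.rpow_pos_of_pos hx r)] at h1
  have h2 : x ^ r = x ^ (r - 1) * x := by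
    rw [← Real.rpow_add_one hx.ne', sub_add_cancel]
  have h3 : (y / x) * x ^ r = x ^ (r - 1) * y := by rw [h2]; field_simp
  linear_combination h1 - r * h3

/-! ### Functionals supporting the r-th power of the norm -/

section

variable {E : Type*} [NormedAddCommGroup E] [NormedSpace ℝ E] [Lattice E] [IsOrderedAddMonoid E]
  [IsOrderedModule ℝ E] [HasSolidNorm E] {r : ℝ}

/-- A linear functional supporting the convex function `‖·‖ ^ r / r` at `e`. -/
structure IsSupporting (r : ℝ) (F : E →ₗ[ℝ] ℝ) (e : E) : Prop where
  young : ∀ f, r * F f ≤ (r - 1) * ‖e‖ ^ r + ‖f‖ ^ r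
  self : F e = ‖e‖ ^ r

namespace IsSupporting

variable {F : E →ₗ[ℝ] ℝ} {e c f : E}

lemma continuous (hr : 1 ≤ r) (hF : IsSupporting r F e) : Continuous F := by
  have hr0 : 0 < r := by linarith
  have he : 0 ≤ ‖e‖ ^ r := Real.rpow_nonneg (norm_nonneg _) r
  have key : ∀ f, r * F f ≤ ((r - 1) * ‖e‖ ^ r + 1) * ‖f‖ := fun f => by
    rcases eq_or_ne f 0 with rfl | hf
    · simp
    have hf' : 0 < ‖f‖ := norm_pos_iff.2 hf
    have := hF.young (‖f‖⁻¹ • f)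
    rw [norm_smul, norm_inv, norm_norm, inv_mul_cancel₀ hf'.ne', Real.one_rpow, map_smul,
      smul_eq_mul] at this
    calc r * F f = r * (‖f‖⁻¹ * F f) * ‖f‖ := by field_simp
      _ ≤ _ := mul_le_mul_of_nonneg_right this hf'.le
  refine AddMonoidHomClass.continuous_of_bound F (((r - 1) * ‖e‖ ^ r + 1) / r) fun f => ?_
  rw [div_mul_eq_mul_div, le_div_iff₀ hr0, Real.norm_eq_abs, mul_comm,
    ← abs_of_pos hr0, ← abs_mul, abs_of_pos hr0]
  refine abs_le'.2 ⟨key f, ?_⟩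
  have := key (-f)
  rw [map_neg, norm_neg] at this
  linarith

/-- A supporting functional takes the value `‖c‖ ^ r` at every component `c` of `e`. -/
lemma apply_component (hr : 1 ≤ r) (hE : DisjointlyAdditive r E) (hF : IsSupporting r F e)
    (hc : Perp c (e - c)) : F c = ‖c‖ ^ r := by
  have hm : ‖e‖ ^ r = ‖c‖ ^ r + ‖e - c‖ ^ r := by
    have := norm_add_rpow hE hc
    rwa [add_sub_cancel] at this
  -- Along e + t c = (1 + t) c + (e - c) the r-th power of the norm is explicit by disjoint
  -- additivity. The Young inequality becomes an equality at t = 0, so the derivative there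
  -- vanishes.
  have key : ∀ t : ℝ, -1 ≤ t → 0 ≤ ((1 + t) ^ r - 1) * ‖c‖ ^ r - r * t * F c := fun t ht => by
    have h0 : 0 ≤ 1 + t := by linarith
    have h1 := hF.young ((1 + t) • c + (e - c))
    rw [norm_add_rpow hE (hc.smul_left _), norm_smul, Real.norm_of_nonneg h0,
      Real.mul_rpow h0 (norm_nonneg _)] at h1
    have h2 : (1 + t) • c + (e - c) = e + t • c := by rw [add_smul, one_smul]; abel
    rw [h2, map_add, map_smul, hF.self, smul_eq_mul] at h1
    linear_combination h1 - hm
  have hmin : IsLocalMin (fun t : ℝ => ((1 + t) ^ r - 1) * ‖c‖ ^ r - r * t * F c) 0 := by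
    filter_upwards [Ici_mem_nhds (show (-1 : ℝ) < 0 by norm_num)] with t ht
    simpa using key t ht
  have hder : HasDerivAt (fun t : ℝ => ((1 + t) ^ r - 1) * ‖c‖ ^ r - r * t * F c)
      (1 * r * (1 + 0) ^ (r - 1) * ‖c‖ ^ r - r * 1 * F c) 0 := by
    refine HasDerivAt.sub (HasDerivAt.mul_const (HasDerivAt.sub_const _ ?_) _)
      (HasDerivAt.mul_const ((hasDerivAt_id _).const_mul r) _)
    exact ((hasDerivAt_id (0 : ℝ)).const_add 1).rpow_const (Or.inr hr)
  have := hmin.hasDerivAt_eq_zero hder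
  simp only [add_zero, Real.one_rpow] at this
  have hr0 : r ≠ 0 := by linarith
  have h3 : r * (F c) = r * ‖c‖ ^ r := by linarith
  exact mul_left_cancel₀ hr0 h3

/-- Apply the Young inequality to e - h, whose norm is at most ‖e‖. -/
lemma nonneg_of_le (hr : 1 ≤ r) (hF : IsSupporting r F e) {h : E} (h0 : 0 ≤ h) (he : h ≤ e) :
    0 ≤ F h := by
  have h1 := hF.young (e - h)
  have h2 : ‖e - h‖ ^ r ≤ ‖e‖ ^ r := Real.rpow_le_rpow (norm_nonneg _)
    (norm_le_norm_of_nonneg_le (sub_nonneg.2 he) (sub_le_self _ h0)) (by linarith)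
  rw [map_sub, hF.self] at h1
  have h3 : 0 ≤ r * F h := by linarith
  exact nonneg_of_mul_nonneg_right h3 (by linarith)

lemma nonneg_of_le_smul (hr : 1 ≤ r) (hF : IsSupporting r F e) {h : E} (h0 : 0 ≤ h) {n : ℝ}
    (hn : 0 ≤ n) (he : h ≤ n • e) : 0 ≤ F h := by
  rcases hn.eq_or_lt with rfl | hn
  · rw [zero_smul] at he
    simp [le_antisymm he h0]
  · have h1 : n⁻¹ • h ≤ e := by
      have := smul_le_smul_of_nonneg_left he (inv_nonneg.2 hn.le)
      rwa [inv_smul_smul₀ hn.ne'] at this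
    have h2 := hF.nonneg_of_le hr (smul_nonneg (inv_nonneg.2 hn.le) h0) h1
    rw [map_smul, smul_eq_mul] at h2
    exact nonneg_of_mul_nonneg_right h2 (inv_pos.2 hn)

variable [CompleteSpace E]

/-- In the Young inequality for Π_c f + (e - c) the contributions of e - c cancel. Thus F restricted
to the band of c supports at c. -/
lemma young_bandProj (hr : 1 ≤ r) (hE : DisjointlyAdditive r E) (hF : IsSupporting r F e)
    (hc0 : 0 ≤ c) (hc : Perp c (e - c)) (f : E) :
    r * F (bandProj c f) ≤ (r - 1) * ‖c‖ ^ r + ‖bandProj c f‖ ^ r := by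
  have hp : Perp (bandProj c f) (e - c) := mem_band.1 (bandProj_mem hr hE hc0 f) _ hc.symm
  have h1 := hF.young (bandProj c f + (e - c))
  have h2 := norm_add_rpow hE hc
  rw [norm_add_rpow hE hp, map_add, map_sub, hF.self, hF.apply_component hr hE hc] at h1
  rw [add_sub_cancel] at h2
  rw [h2] at h1
  linear_combination h1

/-- Jensen's inequality for the mean a of f over c. For a > 0 it is `young_bandProj` at f / a, which
has mean 1; a negative mean reduces to this by passing to -f. -/
lemma rpow_mul_le (hr : 1 ≤ r) (hE : DisjointlyAdditive r E) (hF : IsSupporting r F e)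
    (hc0 : 0 ≤ c) (hcne : c ≠ 0) (hc : Perp c (e - c)) (f : E) :
    |F (bandProj c f) / ‖c‖ ^ r| ^ r * ‖c‖ ^ r ≤ ‖bandProj c f‖ ^ r := by
  have hm : 0 < ‖c‖ ^ r := Real.rpow_pos_of_pos (norm_pos_iff.2 hcne) r
  have key : ∀ f, 0 < F (bandProj c f) →
      (F (bandProj c f) / ‖c‖ ^ r) ^ r * ‖c‖ ^ r ≤ ‖bandProj c f‖ ^ r := fun f hf => by
    set a := F (bandProj c f) / ‖c‖ ^ r with ha
    have ha0 : 0 < a := by positivity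
    have h1 := hF.young_bandProj hr hE hc0 hc (a⁻¹ • f)
    rw [map_smul, map_smul, norm_smul, norm_inv, Real.norm_of_nonneg ha0.le, smul_eq_mul,
      Real.mul_rpow (by positivity) (norm_nonneg _), Real.inv_rpow ha0.le] at h1
    have h2 : a⁻¹ * F (bandProj c f) = ‖c‖ ^ r := by rw [ha]; field_simp
    rw [h2] at h1
    have h3 : ‖c‖ ^ r ≤ (a ^ r)⁻¹ * ‖bandProj c f‖ ^ r := by linarith
    have har : 0 < a ^ r := Real.rpow_pos_of_pos ha0 r
    rwa [inv_mul_eq_div, le_div_iff₀ har, mul_comm] at h3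
  rcases lt_trichotomy (F (bandProj c f)) 0 with h | h | h
  · have := key (-f) (by rw [map_neg, map_neg]; linarith)
    rw [map_neg, map_neg, norm_neg, neg_div] at this
    rwa [abs_of_neg (div_neg_of_neg_of_pos h hm)]
  · rw [h]
    simp only [zero_div, abs_zero]
    rw [Real.zero_rpow (by linarith), zero_mul]
    positivity
  · rw [abs_of_pos (by positivity)]
    exact key f h

end IsSupporting

variable [CompleteSpace E]

/-- A norming functional of e from Hahn–Banach, scaled by ‖e‖^(r-1). -/
lemma exists_isSupporting (hr : 1 ≤ r) (e : E) :
    ∃ F : E →ₗ[ℝ] ℝ, IsSupporting r F e := by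
  have hr0 : r ≠ 0 := by linarith
  rcases eq_or_ne e 0 with rfl | hne
  · refine ⟨0, ⟨fun f => ?_, ?_⟩⟩
    · have : 0 ≤ ‖f‖ ^ r := by positivity
      simpa [Real.zero_rpow hr0]
    · simp [Real.zero_rpow hr0]
  obtain ⟨g, hg1, hg2⟩ := exists_dual_vector'' ℝ e
  have hpos : 0 < ‖e‖ := norm_pos_iff.2 hne
  refine ⟨‖e‖ ^ (r - 1) • (g : E →ₗ[ℝ] ℝ), ⟨fun f => ?_, ?_⟩⟩
  · have h1 : g f ≤ ‖f‖ := by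
      have := (le_abs_self _).trans (g.le_of_opNorm_le hg1 f)
      simpa using this
    have h2 : r * (‖e‖ ^ (r - 1) * g f) ≤ r * (‖e‖ ^ (r - 1) * ‖f‖) := by gcongr
    exact h2.trans (mul_rpow_sub_one_mul_le hr hpos (norm_nonneg f))
  · change ‖e‖ ^ (r - 1) * g e = _
    rw [hg2]
    change ‖e‖ ^ (r - 1) * ‖e‖ = _
    rw [← Real.rpow_add_one hpos.ne', sub_add_cancel]

/-! ### Freudenthal's spectral theorem -/

section Freudenthal

variable (hr : 1 ≤ r) (hE : DisjointlyAdditive r E) {e g : E}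

include hr hE

/-- The middle term is the slice of a between the heights 0 and δ e. It equals δ e where a > δ e, is
at most δ e where a > 0, and vanishes elsewhere. -/
lemma sub_posPart_sub_le (he : 0 ≤ e) (a : E) {δ : ℝ} (hδ : 0 ≤ δ) :
    δ • bandProj (a - δ • e)⁺ e ≤ a⁺ - (a - δ • e)⁺ ∧
      a⁺ - (a - δ • e)⁺ ≤ δ • bandProj a⁺ e := by
  have hδe : 0 ≤ δ • e := smul_nonneg hδ he
  have hy0 : 0 ≤ (a - δ • e)⁺ := posPart_nonneg _
  have ha0 : 0 ≤ a⁺ := posPart_nonneg _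
  have hmono : (a - δ • e)⁺ ≤ a⁺ := posPart_mono (sub_le_self _ hδe)
  have hdiff : 0 ≤ a⁺ - (a - δ • e)⁺ := sub_nonneg.2 hmono
  constructor
  · have h1 : δ • bandProj (a - δ • e)⁺ e = bandProj (a - δ • e)⁺ (a - (a - δ • e)⁺) := by
      have h2 : a - (a - δ • e)⁺ = δ • e - (a - δ • e)⁻ := by
        have := posPart_sub_negPart (a - δ • e)
        rw [sub_eq_iff_eq_add] at this
        rw [this]; abel
      rw [h2, map_sub, map_smul,
        bandProj_of_perp hr hE hy0 (perp_posPart_negPart (a - δ • e)).symm, sub_zero]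
    rw [h1]
    exact (bandProj_mono hr hE hy0 (sub_le_sub_right (le_posPart a) _)).trans
      (bandProj_le_self hr hE hy0 hdiff)
  · have h1 : a⁺ - (a - δ • e)⁺ ∈ band a⁺ :=
      mem_band_of_abs_le (abs_le_of_nonneg_le hdiff (sub_le_self _ hy0))
    rw [← bandProj_of_mem hr hE ha0 h1, ← map_smul]
    refine bandProj_mono hr hE ha0 ?_
    rw [sub_le_iff_le_add']
    refine sup_le ?_ (add_nonneg hy0 hδe)
    rw [← sub_le_iff_le_add]
    exact le_posPart _

/-- Freudenthal's spectral theorem: the elements of `[0, n • e]` are limits of combinations of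
their spectral components. -/
lemma mem_of_spectral_components (he : 0 ≤ e) (hg : 0 ≤ g) {n : ℕ} (hgn : g ≤ (n : ℝ) • e)
    {L : Submodule ℝ E} (hL : IsClosed (L : Set E))
    (hc : ∀ t : ℝ, bandProj (g - t • e)⁺ e ∈ L) : g ∈ L := by
  have key : ∀ k : ℕ, ∃ S ∈ L, ‖g - S‖ ≤ (1 / ((k : ℝ) + 1)) * ‖e‖ := by
    intro k
    set δ : ℝ := 1 / ((k : ℝ) + 1) with hδ
    have hδ0 : 0 ≤ δ := by positivity
    -- As N δ = n and g ≤ n e, the N slices of thickness δ exhaust g.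
    set N := n * (k + 1) with hN
    set a : ℕ → E := fun i => g - ((i : ℝ) * δ) • e with ha
    have hsucc : ∀ i, a (i + 1) = a i - δ • e := fun i => by
      simp only [ha]; push_cast; rw [add_mul, one_mul, add_smul]; abel
    have hstep := fun i => sub_posPart_sub_le hr hE he (a i) hδ0
    simp only [← hsucc] at hstep
    refine ⟨∑ i ∈ Finset.range N, δ • bandProj (a (i + 1))⁺ e,
      sum_mem fun i _ => L.smul_mem _ (hc _), ?_⟩
    have hNδ : (N : ℝ) * δ = n := by rw [hN, hδ]; push_cast; field_simp
    have hgs : g = ∑ i ∈ Finset.range N, ((a i)⁺ - (a (i + 1))⁺) := by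
      rw [Finset.sum_range_sub' (fun i => (a i)⁺)]
      have h0 : (a 0)⁺ = g := by simp [ha, hg]
      have h1 : (a N)⁺ = 0 := by
        rw [posPart_eq_zero]; simp only [ha, hNδ]; exact sub_nonpos.2 hgn
      rw [h0, h1, sub_zero]
    have h1 : 0 ≤ g - ∑ i ∈ Finset.range N, δ • bandProj (a (i + 1))⁺ e := by
      rw [sub_nonneg]
      conv_rhs => rw [hgs]
      exact Finset.sum_le_sum fun i _ => (hstep i).1
    have h2 : g - ∑ i ∈ Finset.range N, δ • bandProj (a (i + 1))⁺ e ≤ δ • e := by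
      -- The upper sum exceeds the lower one by a telescoping sum, which is at most its first term
      -- and so at most δ e.
      have h3 : g ≤ ∑ i ∈ Finset.range N, δ • bandProj (a i)⁺ e := by
        conv_lhs => rw [hgs]
        exact Finset.sum_le_sum fun i _ => (hstep i).2
      have h4 : ∑ i ∈ Finset.range N, δ • bandProj (a i)⁺ e -
          ∑ i ∈ Finset.range N, δ • bandProj (a (i + 1))⁺ e =
          δ • bandProj (a 0)⁺ e - δ • bandProj (a N)⁺ e := by
        rw [← Finset.sum_sub_distrib, Finset.sum_range_sub' (fun i => δ • bandProj (a i)⁺ e)]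
      refine (sub_le_sub_right h3 _).trans ?_
      rw [h4]
      refine (sub_le_self _ (smul_nonneg hδ0 (bandProj_nonneg hr hE (posPart_nonneg _) he))).trans
        (smul_le_smul_of_nonneg_left (bandProj_le_self hr hE (posPart_nonneg _) he) hδ0)
    calc _ ≤ ‖δ • e‖ := norm_le_norm_of_nonneg_le h1 h2
      _ = δ * ‖e‖ := by rw [norm_smul, Real.norm_of_nonneg hδ0]
  choose S hSL hS using key
  refine hL.mem_of_tendsto (f := S) (b := atTop) ?_ (Eventually.of_forall hSL)
  rw [tendsto_iff_norm_sub_tendsto_zero]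
  refine squeeze_zero (fun _ => norm_nonneg _)
    (fun k => (norm_sub_rev _ _).trans_le (hS k)) ?_
  simpa using tendsto_one_div_add_atTop_nhds_zero_nat.mul_const ‖e‖

/-- Within a closed sublattice `C`, the elements of the band of `e ∈ C` are approximated by linear
combinations of components of `e` in `C`. -/
lemma mem_of_components {C : Submodule ℝ E} (hC : IsClosedSublattice C) (he : 0 ≤ e) (heC : e ∈ C)
    {L : Submodule ℝ E} (hL : IsClosed (L : Set E))
    (hc : ∀ c ∈ C, 0 ≤ c → c ≤ e → Perp c (e - c) → c ∈ L) (hg : g ∈ band e) (hgC : g ∈ C) :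
    g ∈ L := by
  have key : ∀ g ∈ C, 0 ≤ g → g ∈ band e → g ∈ L := fun g hgC hg0 hg => by
    have h1 := tendsto_bandProj hr hE he hg0
    rw [bandProj_of_mem hr hE he hg] at h1
    refine hL.mem_of_tendsto h1 (Eventually.of_forall fun n => ?_)
    refine mem_of_spectral_components hr hE he (le_inf hg0 (smul_nonneg n.cast_nonneg he))
      inf_le_right hL fun t => ?_
    set u := (g ⊓ (n : ℝ) • e - t • e)⁺ with hu
    have hu0 : 0 ≤ u := posPart_nonneg _
    have huC : u ∈ C := hC.sup_mem _ (sub_mem (hC.inf_mem _ hgC _ (C.smul_mem _ heC))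
      (C.smul_mem _ heC)) _ (zero_mem C)
    refine hc _ (bandProj_mem_sublattice hr hE hC huC hu0 heC) (bandProj_nonneg hr hE hu0 he)
      (bandProj_le_self hr hE hu0 he) ?_
    exact mem_band.1 (bandProj_mem hr hE hu0 e) _
      (mem_polar_singleton.1 (sub_bandProj_mem hr hE hu0 e))
  rw [← posPart_sub_negPart g]
  exact sub_mem (key _ (hC.sup_mem _ hgC _ (zero_mem C)) (posPart_nonneg g)
      (band_mono_abs hg (abs_posPart_le g)))
    (key _ (hC.sup_mem _ (neg_mem hgC) _ (zero_mem C)) (negPart_nonneg g)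
      (band_mono_abs hg (abs_negPart_le g)))

end Freudenthal

lemma isClosedSublattice_top : IsClosedSublattice (⊤ : Submodule ℝ E) :=
  ⟨by simp, fun _ _ _ _ => trivial, fun _ _ _ _ => trivial⟩

end

/-! ### Averages over finite partitions and their limit -/

section

variable {E : Type*} [NormedAddCommGroup E] [NormedSpace ℝ E] [Lattice E] [IsOrderedAddMonoid E]
  [IsOrderedModule ℝ E] [HasSolidNorm E] {r : ℝ} {C : Submodule ℝ E}

/-- The positive cone of a sublattice. -/
def posCone (hC : IsClosedSublattice C) : Sublattice E where
  carrier := {x | x ∈ C ∧ 0 ≤ x}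
  supClosed' _ ha _ hb := ⟨hC.sup_mem _ ha.1 _ hb.1, ha.2.trans le_sup_left⟩
  infClosed' _ ha _ hb := ⟨hC.inf_mem _ ha.1 _ hb.1, le_inf ha.2 hb.2⟩

variable {hC : IsClosedSublattice C}

/-- Distributivity gives any two finite partitions a common refinement, so partitions are directed
and limits along them make sense. -/
noncomputable instance : DistribLattice (posCone hC) where
  le_sup_inf x y z := (AddCommGroup.toDistribLattice E).le_sup_inf (x : E) y z

instance : OrderBot (posCone hC) where
  bot := ⟨0, zero_mem C, le_rfl⟩
  bot_le x := x.2.2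

lemma disjoint_posCone_iff {x y : posCone hC} : Disjoint x y ↔ Perp (x : E) (y : E) := by
  rw [disjoint_iff]
  constructor
  · intro h
    exact .of_inf_eq_zero (congrArg (Subtype.val) h)
  · intro h
    exact Subtype.ext (h.inf_eq_zero x.2.2 y.2.2)

namespace Partition

variable {e : posCone hC} (P Q : Finpartition e)

lemma coe_ne_zero {c : posCone hC} (hc : c ∈ P.parts) : (c : E) ≠ 0 := fun h =>
  P.ne_bot hc (Subtype.ext h)

lemma perp {c d : posCone hC} (hc : c ∈ P.parts) (hd : d ∈ P.parts) (h : c ≠ d) :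
    Perp (c : E) d := disjoint_posCone_iff.1 (P.disjoint hc hd h)

lemma coe_finset_sup (s : Finset (posCone hC))
    (h : ∀ c ∈ s, ∀ d ∈ s, c ≠ d → Perp (c : E) d) :
    ((s.sup id : posCone hC) : E) = ∑ c ∈ s, (c : E) := by
  classical
  induction s using Finset.induction_on with
  | empty => rfl
  | insert a s ha ih =>
    have hm : ∀ j ∈ s, j ∈ insert a s := fun j hj => Finset.mem_insert_of_mem hj
    have ih' := ih fun c hc d hd => h c (hm c hc) d (hm d hd)
    rw [Finset.sup_insert, Finset.sum_insert ha, ← ih']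
    have hp : Perp (a : E) (s.sup id : posCone hC) := by
      rw [ih']
      exact (Perp.sum_left fun j hj => h j (hm j hj) a (Finset.mem_insert_self _ _)
        fun e => ha (e ▸ hj)).symm
    have := inf_add_sup (a : E) (s.sup id : posCone hC)
    rw [hp.inf_eq_zero a.2.2 (s.sup id).2.2, zero_add] at this
    exact this

lemma sum_coe : ∑ c ∈ P.parts, (c : E) = e := by
  rw [← coe_finset_sup _ fun c hc d hd h => perp P hc hd h, P.sup_parts]

lemma perp_sub {c : posCone hC} (hc : c ∈ P.parts) : Perp (c : E) (e - c) := by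
  classical
  rw [← sum_coe P, ← Finset.sum_erase_add _ _ hc, add_sub_cancel_right]
  exact (Perp.sum_left fun d hd => perp P (Finset.mem_of_mem_erase hd) hc
    (Finset.ne_of_mem_erase hd)).symm

variable {P Q} in
open Classical in
-- The pieces inside d are disjoint, so their sum is at most d. Both partitions sum to e, so the
-- nonnegative defects d - ∑ c add up to zero and each one vanishes.
lemma sum_fiber {σ : posCone hC → posCone hC}
    (h1 : ∀ c ∈ P.parts, σ c ∈ Q.parts) (h2 : ∀ c ∈ P.parts, c ≤ σ c) {d : posCone hC}
    (hd : d ∈ Q.parts) : ∑ c ∈ P.parts with σ c = d, (c : E) = d := by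
  have hle : ∀ d ∈ Q.parts, ∑ c ∈ P.parts with σ c = d, (c : E) ≤ d := fun d _ => by
    refine sum_le_of_perp _ _ d.2.2 (fun c hc c' hc' h => ?_) (fun c _ => c.2.2) fun c hc => ?_
    · exact perp P (Finset.mem_filter.1 hc).1 (Finset.mem_filter.1 hc').1 h
    · obtain ⟨hc1, rfl⟩ := Finset.mem_filter.1 hc
      exact h2 c hc1
  have hsum : ∑ d ∈ Q.parts, ((d : E) - ∑ c ∈ P.parts with σ c = d, (c : E)) = 0 := by
    rw [Finset.sum_sub_distrib, Finset.sum_fiberwise_of_maps_to h1, sum_coe, sum_coe, sub_self]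
  have := (Finset.sum_eq_zero_iff_of_nonneg fun d hd => sub_nonneg.2 (hle d hd)).1 hsum d hd
  exact (sub_eq_zero.1 this).symm

end Partition

variable {e : posCone hC}

/-- The averaging operator of a finite partition of `e` relative to a functional `F`. -/
noncomputable def average (r : ℝ) (F : E →ₗ[ℝ] ℝ) (P : Finpartition e) : E →ₗ[ℝ] E :=
  ∑ c ∈ P.parts, ((‖(c : E)‖ ^ r)⁻¹ • F ∘ₗ bandProj (c : E)).smulRight (c : E)

/-- The mean value of `f` over the component `c`. -/
noncomputable def meanValue (r : ℝ) (F : E →ₗ[ℝ] ℝ) (f : E) (c : E) : ℝ :=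
  F (bandProj c f) / ‖c‖ ^ r

lemma average_apply (F : E →ₗ[ℝ] ℝ) (P : Finpartition e) (f : E) :
    average r F P f = ∑ c ∈ P.parts, meanValue r F f c • (c : E) := by
  rw [average, LinearMap.sum_apply]
  refine Finset.sum_congr rfl fun c _ => ?_
  rw [LinearMap.smulRight_apply, LinearMap.smul_apply, LinearMap.comp_apply, smul_eq_mul,
    inv_mul_eq_div, meanValue]

/-- The square mean of the averages of `f` over a partition. -/
noncomputable def energy (r : ℝ) (F : E →ₗ[ℝ] ℝ) (f : E) (P : Finpartition e) : ℝ :=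
  ∑ c ∈ P.parts, meanValue r F f c ^ 2 * ‖(c : E)‖ ^ r

variable [CompleteSpace E] (hr : 1 ≤ r) (hE : DisjointlyAdditive r E) {F : E →ₗ[ℝ] ℝ}

include hr hE

lemma norm_average_rpow (P : Finpartition e) (a : posCone hC → ℝ) :
    ‖∑ c ∈ P.parts, a c • (c : E)‖ ^ r = ∑ c ∈ P.parts, |a c| ^ r * ‖(c : E)‖ ^ r := by
  rw [norm_sum_rpow hr hE P.parts (fun c => a c • (c : E))]
  · refine Finset.sum_congr rfl fun c _ => ?_
    rw [norm_smul, Real.norm_eq_abs, Real.mul_rpow (abs_nonneg _) (norm_nonneg _)]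
  · intro c hc d hd h
    exact ((Partition.perp P hc hd h).smul_left _).smul_right _

/-- Jensen's inequality on each piece, summed by disjoint additivity. -/
lemma norm_average_le (hF : IsSupporting r F e) (P : Finpartition e) (f : E) :
    ‖average r F P f‖ ≤ ‖f‖ := by
  have hr0 : 0 < r := by linarith
  rw [← Real.rpow_le_rpow_iff (norm_nonneg _) (norm_nonneg _) hr0, average_apply,
    norm_average_rpow hr hE]
  refine le_trans (Finset.sum_le_sum fun c hc => ?_) (norm_sum_bandProj_rpow_le hr hE P.parts
    (fun c => (c : E)) (fun c _ => c.2.2) (fun c hc d hd h => Partition.perp P hc hd h) f)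
  exact hF.rpow_mul_le hr hE c.2.2 (Partition.coe_ne_zero P hc) (Partition.perp_sub P hc) f

lemma average_nonneg (hF : IsSupporting r F e) (P : Finpartition e) {f : E} (hf : 0 ≤ f) :
    0 ≤ average r F P f := by
  rw [average_apply]
  refine Finset.sum_nonneg fun c hc => smul_nonneg (div_nonneg ?_ (by positivity)) c.2.2
  -- Positivity of F is known only below multiples of e, so Π_c f is approached by f ⊓ n c.
  have h1 := ((hF.continuous hr).tendsto _).comp (tendsto_bandProj hr hE c.2.2 hf)
  refine ge_of_tendsto' h1 fun n => ?_
  refine hF.nonneg_of_le_smul hr (le_inf hf (smul_nonneg n.cast_nonneg c.2.2)) n.cast_nonneg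
    (inf_le_right.trans ?_)
  exact smul_le_smul_of_nonneg_left (P.le hc) n.cast_nonneg

omit hr hE in
lemma average_mem (P : Finpartition e) (f : E) : average r F P f ∈ C := by
  rw [average_apply]
  exact sum_mem fun c _ => C.smul_mem _ c.2.1

omit hr hE in
lemma average_mem_band (P : Finpartition e) (f : E) : average r F P f ∈ band (e : E) := by
  rw [average_apply]
  exact sum_mem fun c hc => Submodule.smul_mem _ _
    (mem_band_of_abs_le (abs_le_of_nonneg_le c.2.2 (P.le hc)))

lemma average_of_perp (P : Finpartition e) {f : E} (hf : Perp f e) : average r F P f = 0 := by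
  rw [average_apply]
  refine Finset.sum_eq_zero fun c hc => ?_
  rw [meanValue, bandProj_of_perp hr hE c.2.2
    (hf.mono_right (abs_le_of_nonneg_le c.2.2 (P.le hc))), map_zero, zero_div, zero_smul]

open Classical in
-- Once P refines {d, e - d}, each piece lies below d and has mean 1, or is disjoint from d and has
-- mean 0.
lemma average_component (hF : IsSupporting r F e) {d : E} (hd : d ∈ C) (hd0 : 0 ≤ d)
    (hde : d ≤ e) (hp : Perp d (e - d)) :
    ∃ Q : Finpartition e, ∀ P ≤ Q, average r F P d = d := by
  let x : posCone hC := ⟨d, hd, hd0⟩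
  let y : posCone hC := ⟨e - d, sub_mem e.2.1 hd, sub_nonneg.2 hde⟩
  have hxy : Disjoint x y := disjoint_posCone_iff.2 hp
  have hsup : x ⊔ y = e := by
    refine Subtype.ext ?_
    have := inf_add_sup (x : E) (y : E)
    rw [hp.inf_eq_zero hd0 y.2.2, zero_add, show (x : E) + (y : E) = e from
      add_sub_cancel d (e : E)] at this
    exact this
  have hind : ({x, y} : Finset (posCone hC)).SupIndep id := by
    rcases eq_or_ne x y with h | h
    · rw [h, Finset.pair_eq_singleton]; exact Finset.supIndep_singleton _ _
    · exact (Finset.supIndep_pair h).2 hxy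
  -- `ofErase` drops a zero piece, which occurs if d = 0 or d = e.
  refine ⟨Finpartition.ofErase {x, y} hind (by simpa using hsup), fun P hP => ?_⟩
  have key : ∀ c ∈ P.parts, meanValue r F d c • (c : E) = bandProj (c : E) d := by
    intro c hc
    obtain ⟨z, hz, hcz⟩ := hP hc
    have hz' : z = x ∨ z = y := by
      have := Finset.mem_of_mem_erase hz
      simpa using this
    have hm : 0 < ‖(c : E)‖ ^ r :=
      Real.rpow_pos_of_pos (norm_pos_iff.2 (Partition.coe_ne_zero P hc)) r
    rcases hz' with rfl | rfl
    · have hcd : (c : E) ≤ d := hcz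
      have h1 : bandProj (c : E) d = c := by
        refine bandProj_eq hr hE c.2.2 (self_mem_band _) ?_
        rw [mem_polar_singleton]
        refine (Partition.perp_sub P hc).symm.mono_left ?_
        exact abs_le_of_nonneg_le (sub_nonneg.2 hcd) (sub_le_sub_right hde _)
      rw [meanValue, h1, hF.apply_component hr hE (Partition.perp_sub P hc), div_self hm.ne',
        one_smul]
    · have h1 : bandProj (c : E) d = 0 := bandProj_of_perp hr hE c.2.2
        (hp.mono_right (abs_le_of_nonneg_le c.2.2 hcz))
      rw [meanValue, h1, map_zero, zero_div, zero_smul]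
  rw [average_apply, Finset.sum_congr rfl key, ← bandProj_sum hr hE _ _ (fun c _ => c.2.2)
    (fun c hc d hd h => Partition.perp P hc hd h), Partition.sum_coe]
  exact bandProj_of_mem hr hE e.2.2 (mem_band_of_abs_le (abs_le_of_nonneg_le hd0 hde))

lemma meanValue_mem_Icc (hF : IsSupporting r F e) (P : Finpartition e) {f : E} (hf : 0 ≤ f)
    (hfe : f ≤ e) {c : posCone hC} (hc : c ∈ P.parts) :
    0 ≤ meanValue r F f c ∧ meanValue r F f c ≤ 1 := by
  have hm : 0 < ‖(c : E)‖ ^ r :=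
    Real.rpow_pos_of_pos (norm_pos_iff.2 (Partition.coe_ne_zero P hc)) r
  have hP0 := bandProj_nonneg hr hE c.2.2 hf
  refine ⟨div_nonneg (hF.nonneg_of_le hr hP0
    ((bandProj_le_self hr hE c.2.2 hf).trans hfe)) hm.le, ?_⟩
  rw [meanValue, div_le_one hm, ← hF.apply_component hr hE (Partition.perp_sub P hc),
    ← sub_nonneg, ← map_sub]
  have h1 : bandProj (c : E) f ≤ c := by
    have h2 : bandProj (c : E) (e : E) = c := bandProj_eq hr hE c.2.2 (self_mem_band _)
      (mem_polar_singleton.2 (Partition.perp_sub P hc).symm)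
    rw [← h2]
    conv_lhs => rw [h2]
    exact bandProj_mono hr hE c.2.2 hfe
  exact hF.nonneg_of_le hr (sub_nonneg.2 h1) ((sub_le_self _ hP0).trans (P.le hc))

lemma norm_rpow_eq_sum (P : Finpartition e) :
    ‖(e : E)‖ ^ r = ∑ c ∈ P.parts, ‖(c : E)‖ ^ r := by
  rw [← Partition.sum_coe P]
  exact norm_sum_rpow hr hE P.parts _ fun c hc d hd h => Partition.perp P hc hd h

lemma energy_le (hF : IsSupporting r F e) (P : Finpartition e) {f : E} (hf : 0 ≤ f)
    (hfe : f ≤ e) : energy r F f P ≤ ‖(e : E)‖ ^ r := by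
  rw [norm_rpow_eq_sum hr hE P]
  refine Finset.sum_le_sum fun c hc => ?_
  obtain ⟨h0, h1⟩ := meanValue_mem_Icc hr hE hF P hf hfe hc
  exact mul_le_of_le_one_left (by positivity) (by nlinarith)

open Classical in
-- Pythagoras for martingales: σ sends a piece of P to the piece of Q above it. Means over Q are
-- weighted means of those over P, so the cross term in the expanded square is again the energy of
-- Q.
lemma exists_refinement_sum {P Q : Finpartition e} (hPQ : P ≤ Q) (f : E) :
    ∃ σ : posCone hC → posCone hC,
      (∀ c ∈ P.parts, σ c ∈ Q.parts) ∧
      average r F Q f = ∑ c ∈ P.parts, meanValue r F f (σ c) • (c : E) ∧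
      ∑ c ∈ P.parts, (meanValue r F f c - meanValue r F f (σ c)) ^ 2 * ‖(c : E)‖ ^ r =
        energy r F f P - energy r F f Q := by
  have hex : ∀ c ∈ P.parts, ∃ d ∈ Q.parts, c ≤ d := fun c hc => hPQ hc
  choose! σ h1 h2 using hex
  have hfib := fun d hd => Partition.sum_fiber (d := d) h1 h2 hd
  have hperp : ∀ d : posCone hC, ∀ c ∈ P.parts.filter (σ · = d),
      ∀ c' ∈ P.parts.filter (σ · = d), c ≠ c' → Perp (c : E) c' := fun d c hc c' hc' h =>
    Partition.perp P (Finset.mem_filter.1 hc).1 (Finset.mem_filter.1 hc').1 h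
  refine ⟨σ, h1, ?_, ?_⟩
  · rw [average_apply, ← Finset.sum_fiberwise_of_maps_to h1]
    refine Finset.sum_congr rfl fun d hd => ?_
    conv_lhs => rw [← hfib d hd]
    rw [Finset.smul_sum]
    refine Finset.sum_congr rfl fun c hc => ?_
    rw [(Finset.mem_filter.1 hc).2, hfib d hd]
  · have hm : ∀ d ∈ Q.parts,
        ∑ c ∈ P.parts with σ c = d, ‖(c : E)‖ ^ r = ‖(d : E)‖ ^ r := fun d hd => by
      rw [← norm_sum_rpow hr hE _ _ (hperp d), hfib d hd]
    have hFd : ∀ d ∈ Q.parts,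
        ∑ c ∈ P.parts with σ c = d, F (bandProj (c : E) f) = F (bandProj (d : E) f) :=
      fun d hd => by
        rw [← map_sum, ← bandProj_sum hr hE _ _ (fun c _ => c.2.2) (hperp d), hfib d hd]
    have hmv : ∀ (R : Finpartition e), ∀ c ∈ R.parts,
        meanValue r F f c * ‖(c : E)‖ ^ r = F (bandProj (c : E) f) := fun R c hc =>
      div_mul_cancel₀ _
        (Real.rpow_pos_of_pos (norm_pos_iff.2 (Partition.coe_ne_zero R hc)) r).ne'
    have hA : ∑ c ∈ P.parts, meanValue r F f (σ c) ^ 2 * ‖(c : E)‖ ^ r = energy r F f Q := by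
      rw [energy, ← Finset.sum_fiberwise_of_maps_to h1]
      refine Finset.sum_congr rfl fun d hd => ?_
      rw [← hm d hd, Finset.mul_sum]
      refine Finset.sum_congr rfl fun c hc => ?_
      rw [(Finset.mem_filter.1 hc).2]
    have hB : ∑ c ∈ P.parts, meanValue r F f (σ c) * F (bandProj (c : E) f) =
        energy r F f Q := by
      rw [energy, ← Finset.sum_fiberwise_of_maps_to h1]
      refine Finset.sum_congr rfl fun d hd => ?_
      rw [sq, mul_assoc, hmv Q d hd, ← hFd d hd, Finset.mul_sum]
      refine Finset.sum_congr rfl fun c hc => ?_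
      rw [(Finset.mem_filter.1 hc).2]
    have hsplit : ∑ c ∈ P.parts,
        (meanValue r F f c - meanValue r F f (σ c)) ^ 2 * ‖(c : E)‖ ^ r =
        energy r F f P - 2 * ∑ c ∈ P.parts, meanValue r F f (σ c) * F (bandProj (c : E) f) +
        ∑ c ∈ P.parts, meanValue r F f (σ c) ^ 2 * ‖(c : E)‖ ^ r := by
      rw [energy, Finset.mul_sum, ← Finset.sum_sub_distrib, ← Finset.sum_add_distrib]
      refine Finset.sum_congr rfl fun c hc => ?_
      rw [← hmv P c hc]; ring
    rw [hsplit, hA, hB]; ring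

/-- Passes from square means to the r-norm for every r ≥ 1: differences x of means lie in [-1, 1],
whence |x|^r ≤ |x| ≤ δ + x² / δ. -/
lemma norm_average_sub_rpow_le (hF : IsSupporting r F e) {P Q : Finpartition e} (hPQ : P ≤ Q)
    {f : E} (hf : 0 ≤ f) (hfe : f ≤ e) {δ : ℝ} (hδ : 0 < δ) :
    ‖average r F P f - average r F Q f‖ ^ r ≤
      δ * ‖(e : E)‖ ^ r + δ⁻¹ * (energy r F f P - energy r F f Q) := by
  obtain ⟨σ, h1, h2, h3⟩ := exists_refinement_sum (F := F) hr hE hPQ f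
  rw [h2, average_apply, ← Finset.sum_sub_distrib, ← h3, norm_rpow_eq_sum hr hE P,
    Finset.mul_sum, Finset.mul_sum, ← Finset.sum_add_distrib]
  simp_rw [← sub_smul]
  rw [norm_average_rpow hr hE P fun c => meanValue r F f c - meanValue r F f (σ c)]
  refine Finset.sum_le_sum fun c hc => ?_
  obtain ⟨ha0, ha1⟩ := meanValue_mem_Icc hr hE hF P hf hfe hc
  obtain ⟨hb0, hb1⟩ := meanValue_mem_Icc hr hE hF Q hf hfe (h1 c hc)
  rw [← mul_assoc, ← add_mul]
  refine mul_le_mul_of_nonneg_right ?_ (by positivity)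
  set x := meanValue r F f c - meanValue r F f (σ c) with hx
  have hx1 : |x| ≤ 1 := abs_le.2 ⟨by linarith, by linarith⟩
  have h4 : |x| ^ r ≤ |x| := by
    simpa using Real.rpow_le_rpow_of_exponent_ge' (abs_nonneg x) hx1 zero_le_one hr
  refine h4.trans ?_
  rw [inv_mul_eq_div, ← sq_abs x]
  have h5 : 0 ≤ (|x| - δ) ^ 2 := sq_nonneg _
  have h6 : δ * |x| ≤ δ ^ 2 + |x| ^ 2 := by nlinarith [abs_nonneg x]
  have h7 : δ + |x| ^ 2 / δ = (δ ^ 2 + |x| ^ 2) / δ := by field_simp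
  rw [h7, le_div_iff₀ hδ]
  linarith

lemma energy_anti (f : E) :
    Antitone (energy r F f : Finpartition e → ℝ) := by
  intro P Q hPQ
  obtain ⟨σ, -, -, h3⟩ := exists_refinement_sum (F := F) hr hE hPQ f
  have : 0 ≤ energy r F f P - energy r F f Q := by
    rw [← h3]; exact Finset.sum_nonneg fun c _ => by positivity
  linarith

open Classical in
lemma cauchySeq_average_of_le (hF : IsSupporting r F e) {f : E} (hf : 0 ≤ f) (hfe : f ≤ e) :
    CauchySeq fun P : (Finpartition e)ᵒᵈ => average r F (OrderDual.ofDual P) f := by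
  have hr0 : 0 < r := by linarith
  have hq : CauchySeq fun P : (Finpartition e)ᵒᵈ => energy r F f (OrderDual.ofDual P) := by
    have hmono : Monotone fun P : (Finpartition e)ᵒᵈ => energy r F f (OrderDual.ofDual P) :=
      fun P Q h => energy_anti hr hE f h
    exact (tendsto_atTop_ciSup hmono ⟨‖(e : E)‖ ^ r, by
      rintro _ ⟨P, rfl⟩; exact energy_le hr hE hF _ hf hfe⟩).cauchySeq
  rw [Metric.cauchySeq_iff'] at hq ⊢
  intro ε hε
  have hεr : 0 < ε ^ r := Real.rpow_pos_of_pos hε r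
  set M := ‖(e : E)‖ ^ r with hM
  have hM0 : 0 ≤ M := by positivity
  -- Makes δ M ≤ ε^r / 2; an energy gap below δ ε^r / 2 handles the other half.
  set δ := ε ^ r / (2 * (M + 1)) with hδ
  have hδ0 : 0 < δ := by positivity
  obtain ⟨N, hN⟩ := hq (δ * (ε ^ r / 2)) (by positivity)
  refine ⟨N, fun P hP => ?_⟩
  have h1 := norm_average_sub_rpow_le hr hE hF (P := OrderDual.ofDual P)
    (Q := OrderDual.ofDual N) hP hf hfe hδ0
  have h2 := hN P hP
  rw [Real.dist_eq] at h2
  have h3 := (le_abs_self _).trans_lt h2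
  have h4 : δ⁻¹ * (energy r F f (OrderDual.ofDual P) - energy r F f (OrderDual.ofDual N)) <
      ε ^ r / 2 := by
    rw [inv_mul_lt_iff₀ hδ0]; exact h3
  have h5 : δ * M ≤ ε ^ r / 2 := by
    rw [hδ, div_mul_eq_mul_div, div_le_div_iff₀ (by positivity) (by positivity)]
    nlinarith
  rw [dist_eq_norm, ← Real.rpow_lt_rpow_iff (norm_nonneg _) hε.le hr0]
  linarith

open Classical in
-- As the averages are uniformly contractive, the f with Cauchy averages form a closed subspace. It
-- contains [0, e], hence the band of e by Freudenthal's theorem, and it contains e^⊥, where all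
-- averages vanish.
lemma cauchySeq_average (hF : IsSupporting r F e) (f : E) :
    CauchySeq fun P : (Finpartition e)ᵒᵈ => average r F (OrderDual.ofDual P) f := by
  let L : Submodule ℝ E :=
    { carrier := {f | CauchySeq fun P : (Finpartition e)ᵒᵈ => average r F (OrderDual.ofDual P) f}
      add_mem' := fun {a b} ha hb => by
        simp only [Set.mem_ofPred_eq, map_add] at *
        exact ha.add hb
      zero_mem' := by
        simp only [Set.mem_ofPred_eq, map_zero]
        exact cauchySeq_const 0
      smul_mem' := fun t a ha => by
        simp only [Set.mem_ofPred_eq, map_smul] at *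
        exact (uniformContinuous_const_smul t).comp_cauchySeq ha }
  have hL : IsClosed (L : Set E) := by
    refine isClosed_of_closure_subset fun g hg => ?_
    change CauchySeq _
    rw [Metric.cauchySeq_iff']
    intro ε hε
    obtain ⟨k, hk, hgk⟩ := Metric.mem_closure_iff.1 hg (ε / 3) (by positivity)
    obtain ⟨N, hN⟩ := Metric.cauchySeq_iff'.1 (show CauchySeq _ from hk) (ε / 3) (by positivity)
    refine ⟨N, fun P hP => ?_⟩
    have h1 : ∀ R : Finpartition e, dist (average r F R g) (average r F R k) < ε / 3 := fun R => by
      rw [dist_eq_norm, ← map_sub]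
      exact (norm_average_le hr hE hF R _).trans_lt (by rwa [← dist_eq_norm])
    have h2 := dist_triangle4 (average r F (OrderDual.ofDual P) g)
      (average r F (OrderDual.ofDual P) k) (average r F (OrderDual.ofDual N) k)
      (average r F (OrderDual.ofDual N) g)
    have h3 := h1 (OrderDual.ofDual P)
    have h4 := h1 (OrderDual.ofDual N)
    rw [dist_comm] at h4
    have h5 := hN P hP
    linarith
  have hband : ∀ g ∈ band (e : E), g ∈ L := fun g hg =>
    mem_of_components hr hE isClosedSublattice_top e.2.2 trivial hL
      (fun c _ hc0 hce _ => cauchySeq_average_of_le hr hE hF hc0 hce) hg trivial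
  have hpolar : ∀ g ∈ polar {(e : E)}, g ∈ L := fun g hg => by
    change CauchySeq _
    simp_rw [fun P : Finpartition e => average_of_perp (F := F) hr hE P (mem_polar_singleton.1 hg)]
    exact cauchySeq_const 0
  have := L.add_mem (hband _ (bandProj_mem hr hE e.2.2 f))
    (hpolar _ (sub_bandProj_mem hr hE e.2.2 f))
  rwa [add_sub_cancel] at this

open Classical in
/-- The conditional expectation onto the part of `C` in the band of `e ∈ C`. -/
lemma exists_expectation_band (hC : IsClosedSublattice C) {e : E} (heC : e ∈ C) (he : 0 ≤ e) :
    ∃ T : E →ₗ[ℝ] E, (∀ f, T f ∈ C) ∧ (∀ f, T f ∈ band e) ∧ (∀ f, ‖T f‖ ≤ ‖bandProj e f‖) ∧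
      (∀ f, 0 ≤ f → 0 ≤ T f) ∧ ∀ f ∈ C, f ∈ band e → T f = f := by
  let e' : posCone hC := ⟨e, heC, he⟩
  obtain ⟨F, hF⟩ := exists_isSupporting hr e
  have hF' : IsSupporting r F (e' : E) := hF
  have hcau := fun f => cauchySeq_average hr hE hF' f
  choose T hT using fun f => cauchySeq_tendsto_of_complete (hcau f)
  let T' : E →ₗ[ℝ] E := linearMapOfTendsto T
    (fun P : (Finpartition e')ᵒᵈ => average r F (OrderDual.ofDual P)) (tendsto_pi_nhds.2 hT)
  have hT' : ∀ f, Tendsto (fun P : (Finpartition e')ᵒᵈ => average r F (OrderDual.ofDual P) f) atTop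
      (𝓝 (T' f)) := hT
  have hnorm : ∀ f, ‖T' f‖ ≤ ‖f‖ := fun f =>
    le_of_tendsto' (hT' f).norm fun P => norm_average_le hr hE hF' _ f
  have hpolar : ∀ f ∈ polar {e}, T' f = 0 := fun f hf => by
    refine tendsto_nhds_unique (hT' f) ?_
    simp_rw [fun P : Finpartition e' =>
      average_of_perp (F := F) hr hE P (mem_polar_singleton.1 hf)]
    exact tendsto_const_nhds
  refine ⟨T', fun f => hC.isClosed.mem_of_tendsto (hT' f) (.of_forall fun P => average_mem _ f),
    fun f => (isClosed_band e).mem_of_tendsto (hT' f) (.of_forall fun P =>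
      average_mem_band (e := e') _ f),
    fun f => ?_, fun f hf => ge_of_tendsto' (hT' f) fun P => average_nonneg hr hE hF' _ hf, ?_⟩
  -- T' kills e^⊥, so contractivity at Π_e f gives the sharper bound needed for summing over
  -- disjoint bands.
  · have := hpolar _ (sub_bandProj_mem hr hE he f)
    rw [map_sub, sub_eq_zero] at this
    rw [this]
    exact hnorm _
  · have hcont : Continuous T' := T'.mkContinuous 1 (fun f => by simpa using hnorm f) |>.continuous
    intro f hfC hf
    -- The fixed points form a closed subspace, so components of e in C suffice; their averages are
    -- eventually constant.
    refine mem_of_components hr hE hC he heC (L := LinearMap.eqLocus T' LinearMap.id)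
      (isClosed_eq hcont continuous_id) (fun c hc hc0 hce hp => ?_) hf hfC
    obtain ⟨Q, hQ⟩ := average_component (e := e') hr hE hF' hc hc0 hce hp
    refine tendsto_nhds_unique (hT' c) (tendsto_const_nhds.congr' ?_)
    filter_upwards [eventually_ge_atTop (OrderDual.toDual Q)] with P hP
    exact (hQ _ hP).symm

end

/-! ### Disjoint families; existence and uniqueness of the projection -/

section

variable {E : Type*} [NormedAddCommGroup E] [NormedSpace ℝ E] [Lattice E] [IsOrderedAddMonoid E]
  [IsOrderedModule ℝ E] [HasSolidNorm E] {r : ℝ} {C : Submodule ℝ E}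

/-- A maximal disjoint family of positive elements of `C`. -/
lemma exists_maximal_disjoint_family (C : Submodule ℝ E) :
    ∃ M : Set E, (∀ u ∈ M, u ∈ C ∧ 0 ≤ u) ∧ (∀ u ∈ M, ∀ v ∈ M, u ≠ v → Perp u v) ∧
      ∀ y ∈ C, 0 ≤ y → (∀ u ∈ M, Perp y u) → y = 0 := by
  obtain ⟨M, hM⟩ := zorn_subset
    {M : Set E | (∀ u ∈ M, u ∈ C ∧ 0 ≤ u) ∧ ∀ u ∈ M, ∀ v ∈ M, u ≠ v → Perp u v} (by
      intro c hc hchain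
      refine ⟨⋃₀ c, ⟨?_, ?_⟩, fun s hs => Set.subset_sUnion_of_mem hs⟩
      · rintro u ⟨s, hs, hu⟩
        exact (hc hs).1 u hu
      · rintro u ⟨s, hs, hu⟩ v ⟨t, ht, hv⟩ huv
        rcases hchain.total hs ht with h | h
        · exact (hc ht).2 u (h hu) v hv huv
        · exact (hc hs).2 u hu v (h hv) huv)
  refine ⟨M, hM.prop.1, hM.prop.2, fun y hy hy0 hperp => ?_⟩
  have hins : insert y M ⊆ M := by
    refine hM.le_of_ge ⟨?_, ?_⟩ (Set.subset_insert y M)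
    · rintro u (rfl | hu)
      · exact ⟨hy, hy0⟩
      · exact hM.prop.1 u hu
    · rintro u (rfl | hu) v (rfl | hv) huv
      · exact absurd rfl huv
      · exact hperp v hv
      · exact (hperp u hu).symm
      · exact hM.prop.2 u hu v hv huv
  -- Maximality puts y into M, so y is disjoint from itself.
  exact perp_self_iff.1 (hperp y (hins (Set.mem_insert y M)))

variable [CompleteSpace E] (hr : 1 ≤ r) (hE : DisjointlyAdditive r E)

include hr hE

/-- Disjoint additivity turns the Cauchy criterion for ∑ x i into the one for the series of ‖x i‖^r.
-/
lemma summable_of_perp {ι : Type*} {x : ι → E} (hx : ∀ i j, i ≠ j → Perp (x i) (x j)) {B : ℝ}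
    (hB : ∀ s : Finset ι, ∑ i ∈ s, ‖x i‖ ^ r ≤ B) : Summable x := by
  have hr0 : 0 < r := by linarith
  have hsum : Summable fun i => ‖x i‖ ^ r :=
    summable_of_sum_le (fun i => by positivity) hB
  rw [summable_iff_vanishing_norm] at hsum ⊢
  intro ε hε
  obtain ⟨s, hs⟩ := hsum (ε ^ r) (Real.rpow_pos_of_pos hε r)
  refine ⟨s, fun t ht => ?_⟩
  have h1 := (le_abs_self _).trans_lt (hs t ht)
  rw [← norm_sum_rpow hr hE t x fun i _ j _ => hx i j] at h1
  exact (Real.rpow_lt_rpow_iff (norm_nonneg _) hε.le hr0).1 h1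

variable {M : Set E} (hM0 : ∀ u ∈ M, u ∈ C ∧ 0 ≤ u)
  (hM : ∀ u ∈ M, ∀ v ∈ M, u ≠ v → Perp u v)

include hM0 hM

lemma sum_bandProj_family_le (s : Finset M) (f : E) :
    ∑ u ∈ s, ‖bandProj (u : E) f‖ ^ r ≤ ‖f‖ ^ r :=
  norm_sum_bandProj_rpow_le hr hE s (fun u => (u : E)) (fun u _ => (hM0 u u.2).2)
    (fun u _ v _ h => hM u u.2 v v.2 fun e => h (Subtype.ext e)) f

lemma summable_bandProj (f : E) : Summable fun u : M => bandProj (u : E) f :=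
  summable_of_perp hr hE
    (fun u v h => perp_bandProj_bandProj hr hE (hM0 u u.2).2 (hM0 v v.2).2
      (hM u u.2 v v.2 fun e => h (Subtype.ext e)) f f)
    fun s => sum_bandProj_family_le hr hE hM0 hM s f

lemma sub_tsum_bandProj_perp (f : E) {u : E} (hu : u ∈ M) :
    Perp (f - ∑' v : M, bandProj (v : E) f) u := by
  classical
  have h1 := (summable_bandProj hr hE hM0 hM f).hasSum
  have h2 : Tendsto (fun s : Finset M => f - ∑ v ∈ s, bandProj (v : E) f) atTop
      (𝓝 (f - ∑' v : M, bandProj (v : E) f)) := h1.const_sub f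
  rw [← mem_polar_singleton]
  refine (isClosed_polar _).mem_of_tendsto h2 ?_
  filter_upwards [eventually_ge_atTop {(⟨u, hu⟩ : M)}] with s hs
  have hus : (⟨u, hu⟩ : M) ∈ s := hs (Finset.mem_singleton_self _)
  rw [← Finset.add_sum_erase _ _ hus, ← sub_sub]
  refine sub_mem (sub_bandProj_mem hr hE (hM0 u hu).2 f) (sum_mem fun v hv => ?_)
  rw [mem_polar_singleton]
  exact mem_band.1 (bandProj_mem hr hE (hM0 v v.2).2 f) u
    (hM u hu v v.2 fun e => Finset.ne_of_mem_erase hv (Subtype.ext e.symm))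

variable (hC : IsClosedSublattice C)
  (hmax : ∀ y ∈ C, 0 ≤ y → (∀ u ∈ M, Perp y u) → y = 0)

include hC hmax

/-- The remainder lies in C and is disjoint from the family, so maximality kills it. -/
lemma tsum_bandProj_eq {y : E} (hy : y ∈ C) : ∑' u : M, bandProj (u : E) y = y := by
  set z := y - ∑' u : M, bandProj (u : E) y with hz
  have hzC : z ∈ C := by
    refine sub_mem hy ?_
    refine hC.isClosed.mem_of_tendsto (summable_bandProj hr hE hM0 hM y).hasSum
      (.of_forall fun s => sum_mem fun u _ => ?_)
    exact bandProj_mem_sublattice hr hE hC (hM0 u u.2).1 (hM0 u u.2).2 hy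
  have h1 : |z| = 0 := hmax _ (hC.sup_mem _ hzC _ (neg_mem hzC)) (abs_nonneg z) fun u hu =>
    perp_abs_left.2 (sub_tsum_bandProj_perp hr hE hM0 hM y hu)
  have h2 : Perp z z := by rw [Perp, h1, inf_idem]
  exact (sub_eq_zero.1 (perp_self_iff.1 h2)).symm

lemma sub_tsum_bandProj_mem_polar (f : E) :
    f - ∑' v : M, bandProj (v : E) f ∈ polar (C : Set E) := by
  refine mem_polar.2 fun y hy => ?_
  set g := f - ∑' v : M, bandProj (v : E) f with hg
  refine (mem_polar_singleton.1 ?_ : Perp y g).symm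
  have h1 := (summable_bandProj hr hE hM0 hM y).hasSum
  rw [tsum_bandProj_eq hr hE hM0 hM hC hmax hy] at h1
  refine (isClosed_polar _).mem_of_tendsto h1 (.of_forall fun s => sum_mem fun u _ => ?_)
  exact mem_polar_singleton.2 (mem_band.1 (bandProj_mem hr hE (hM0 u u.2).2 y) g
    (sub_tsum_bandProj_perp hr hE hM0 hM f u.2))

omit hM0 hM hmax in
/-- `E` is the closed span of the ideal generated by `C` and the disjoint complement of `C`. -/
lemma mem_of_dominated_of_polar {L : Submodule ℝ E} (hL : IsClosed (L : Set E))
    (hdom : ∀ y ∈ C, ∀ f, 0 ≤ f → f ≤ y → f ∈ L) (hpol : polar (C : Set E) ≤ L) (f : E) :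
    f ∈ L := by
  obtain ⟨M, hM0, hM, hmax⟩ := exists_maximal_disjoint_family C
  have h1 : ∑' v : M, bandProj (v : E) f ∈ L := by
    refine hL.mem_of_tendsto (summable_bandProj hr hE hM0 hM f).hasSum
      (.of_forall fun s => sum_mem fun u _ => ?_)
    have key : ∀ f, 0 ≤ f → bandProj (u : E) f ∈ L := fun f hf =>
      hL.mem_of_tendsto (tendsto_bandProj hr hE (hM0 u u.2).2 hf) (.of_forall fun n =>
        hdom _ (C.smul_mem (n : ℝ) (hM0 u u.2).1) _
          (le_inf hf (smul_nonneg n.cast_nonneg (hM0 u u.2).2)) inf_le_right)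
    rw [← posPart_sub_negPart f, map_sub]
    exact sub_mem (key _ (posPart_nonneg f)) (key _ (negPart_nonneg f))
  have := add_mem h1 (hpol (sub_tsum_bandProj_mem_polar hr hE hM0 hM hC hmax f))
  rwa [add_sub_cancel] at this

omit hM0 hM hmax in
-- The sum of the expectations onto the bands of a maximal disjoint family. The values are disjoint
-- with ‖S_u f‖ ≤ ‖Π_u f‖, so r-additivity gives both convergence and contractivity.
lemma exists_contractivePositiveProjection :
    ∃ T : E →ₗ[ℝ] C, IsContractivePositiveProjection C T := by
  have hr0 : 0 < r := by linarith
  obtain ⟨M, hM0, hM, hmax⟩ := exists_maximal_disjoint_family C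
  choose S hSC hSb hSn hSp hSf using fun u : M =>
    exists_expectation_band hr hE hC (hM0 u u.2).1 (hM0 u u.2).2
  have hperp : ∀ f, ∀ u v : M, u ≠ v → Perp (S u f) (S v f) := fun f u v h => by
    have h1 : Perp (u : E) v := hM u u.2 v v.2 fun e => h (Subtype.ext e)
    exact (mem_band.1 (hSb v f) _ (mem_band.1 (hSb u f) v h1.symm)).symm
  have hle : ∀ f, ∀ s : Finset M, ∑ u ∈ s, ‖S u f‖ ^ r ≤ ‖f‖ ^ r := fun f s =>
    (Finset.sum_le_sum fun u _ => Real.rpow_le_rpow (norm_nonneg _) (hSn u f) hr0.le).trans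
      (sum_bandProj_family_le hr hE hM0 hM s f)
  have hsum : ∀ f, Summable fun u => S u f := fun f => summable_of_perp hr hE (hperp f) (hle f)
  have hmem : ∀ f, ∑' u, S u f ∈ C := fun f =>
    hC.isClosed.mem_of_tendsto (hsum f).hasSum (.of_forall fun s => sum_mem fun u _ => hSC u f)
  let T : E →ₗ[ℝ] C :=
    { toFun := fun f => ⟨∑' u, S u f, hmem f⟩
      map_add' := fun f g => Subtype.ext (by
        simp only [map_add, Submodule.coe_add]
        exact (hsum f).tsum_add (hsum g))
      map_smul' := fun t f => Subtype.ext (by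
        simp only [map_smul, Submodule.coe_smul, RingHom.id_apply]
        exact (hsum f).tsum_const_smul t) }
  have hT : ∀ f, (T f : E) = ∑' u, S u f := fun f => rfl
  have hband : ∀ f, ∀ u : M, bandProj (u : E) f = 0 → S u f = 0 := fun f u h => by
    have := hSn u f
    rwa [h, norm_zero, norm_le_zero_iff] at this
  refine ⟨T, ⟨fun f => ?_, fun f hf => ?_, fun y => Subtype.ext ?_, fun f hf => Subtype.ext ?_⟩⟩
  · change ‖(T f : E)‖ ≤ ‖f‖
    rw [hT]
    have hlim : Tendsto (fun s : Finset M => ∑ u ∈ s, S u f) atTop (𝓝 (∑' u, S u f)) :=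
      (hsum f).hasSum
    refine le_of_tendsto' hlim.norm fun s => ?_
    rw [← Real.rpow_le_rpow_iff (norm_nonneg _) (norm_nonneg _) hr0,
      norm_sum_rpow hr hE s _ fun u _ v _ => hperp f u v]
    exact hle f s
  · rw [hT]
    exact tsum_nonneg fun u => hSp u f hf
  · refine Eq.trans ?_ (tsum_bandProj_eq hr hE hM0 hM hC hmax y.2)
    refine tsum_congr fun u => ?_
    have hu := hM0 u u.2
    -- S_u sees only Π_u y, which lies in C and is fixed by S_u.
    have h1 : S u (y - bandProj (u : E) y) = 0 := hband _ u (by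
      rw [map_sub, bandProj_of_mem hr hE hu.2 (bandProj_mem hr hE hu.2 _), sub_self])
    rw [map_sub, sub_eq_zero] at h1
    rw [h1]
    exact hSf u _ (bandProj_mem_sublattice hr hE hC hu.1 hu.2 y.2) (bandProj_mem hr hE hu.2 _)
  · rw [hT]
    have : ∀ u, S u f = 0 := fun u =>
      hband f u (bandProj_of_perp hr hE (hM0 u u.2).2 (hf u (hM0 u u.2).1))
    simp [this]

omit hM0 hM hmax in
/-- A contractive positive projection onto `C` preserves the supporting functionals at positive
elements of `C`. -/
lemma IsSupporting.apply_projection {T : E →ₗ[ℝ] C} (hT : IsContractivePositiveProjection C T)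
    {e : E} (heC : e ∈ C) (he : 0 ≤ e) {F : E →ₗ[ℝ] ℝ} (hF : IsSupporting r F e)
    (hF0 : ∀ f, Perp f e → F f = 0) (f : E) : F (T f) = F f := by
  have hr0 : 0 < r := by linarith
  have hFc := hF.continuous hr
  let H : E →ₗ[ℝ] ℝ := F ∘ₗ C.subtype ∘ₗ T
  have hH : IsSupporting r H e := by
    refine ⟨fun f => (hF.young _).trans ?_, ?_⟩
    · have : ‖(T f : E)‖ ^ r ≤ ‖f‖ ^ r :=
        Real.rpow_le_rpow (norm_nonneg _) (hT.contractive f) hr0.le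
      simpa using this
    · have : T e = ⟨e, heC⟩ := hT.proj ⟨e, heC⟩
      change F (T e : E) = _
      rw [this]
      exact hF.self
  have hHc := hH.continuous hr
  let L : Submodule ℝ E := LinearMap.eqLocus H F
  have hL : IsClosed (L : Set E) := isClosed_eq hHc hFc
  -- Both functionals support at e, so they agree at its components and hence on its band.
  have hband : ∀ g ∈ band e, g ∈ L := fun g hg =>
    mem_of_components hr hE isClosedSublattice_top he trivial hL
      (fun c _ _ _ hp => by
        change H c = F c
        rw [hH.apply_component hr hE hp, hF.apply_component hr hE hp]) hg trivial
  refine mem_of_dominated_of_polar hr hE hC hL (fun y hy g hg0 hgy => ?_) (fun g hg => ?_) f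
  · rw [← add_sub_cancel (bandProj e g) g]
    refine add_mem (hband _ (bandProj_mem hr hE he g)) ?_
    have h1 : 0 ≤ g - bandProj e g := sub_nonneg.2 (bandProj_le_self hr hE he hg0)
    -- The part of g off the band lies below an element of C disjoint from e. Since `T` is positive
    -- and fixes that element, the image is disjoint from e and F kills it.
    have h2 : g - bandProj e g ≤ y - bandProj e y := by
      have h3 : 0 ≤ y - g - bandProj e (y - g) :=
        sub_nonneg.2 (bandProj_le_self hr hE he (sub_nonneg.2 hgy))
      rw [map_sub] at h3
      rw [← sub_nonneg]
      convert h3 using 1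
      abel
    have h3 : y - bandProj e y ∈ C := sub_mem hy (bandProj_mem_sublattice hr hE hC heC he hy)
    have h4 : (T (g - bandProj e g) : E) ≤ y - bandProj e y := by
      have h5 := hT.positive _ (sub_nonneg.2 h2)
      have h6 : T (y - bandProj e y) = ⟨_, h3⟩ := hT.proj ⟨_, h3⟩
      rw [map_sub, h6] at h5
      simpa using h5
    have h5 : Perp (T (g - bandProj e g) : E) e :=
      (mem_polar_singleton.1 (sub_bandProj_mem hr hE he y)).mono_left
        (abs_le_of_nonneg_le (hT.positive _ h1) h4)
    change F (T (g - bandProj e g)) = F (g - bandProj e g)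
    rw [hF0 _ h5, hF0 _ (mem_polar_singleton.1 (sub_bandProj_mem hr hE he g))]
  · change F (T g) = F g
    rw [hT.vanish g hg, hF0 g (hg e heC)]
    simp

omit hM0 hM hmax in
lemma contractivePositiveProjection_unique {T S : E →ₗ[ℝ] C}
    (hT : IsContractivePositiveProjection C T) (hS : IsContractivePositiveProjection C S) :
    T = S := by
  have key : ∀ T S : E →ₗ[ℝ] C, IsContractivePositiveProjection C T →
      IsContractivePositiveProjection C S → ∀ f, ((T f : E) - S f)⁺ = 0 := by
    intro T S hT hS f
    set g := (T f : E) - S f with hg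
    have hgC : g ∈ C := sub_mem (T f).2 (S f).2
    have heC : g⁺ ∈ C := hC.sup_mem _ hgC _ (zero_mem C)
    have he : 0 ≤ g⁺ := posPart_nonneg g
    obtain ⟨G, hG⟩ := exists_isSupporting hr g⁺
    -- Composing with the band projection keeps the support property and makes the functional vanish
    -- on the disjoint complement of g⁺.
    let F : E →ₗ[ℝ] ℝ := G ∘ₗ bandProj g⁺
    have hF : IsSupporting r F g⁺ := by
      refine ⟨fun f => (hG.young _).trans ?_, ?_⟩
      · have : ‖bandProj g⁺ f‖ ^ r ≤ ‖f‖ ^ r :=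
          Real.rpow_le_rpow (norm_nonneg _) (norm_bandProj_le hr hE he f) (by linarith)
        simpa using this
      · change G (bandProj g⁺ g⁺) = _
        rw [bandProj_self hr hE he, hG.self]
    have hF0 : ∀ f, Perp f g⁺ → F f = 0 := fun f hf => by
      change G (bandProj g⁺ f) = 0
      rw [bandProj_of_perp hr hE he hf, map_zero]
    have h1 := hF.apply_projection hr hE hC hT heC he hF0 f
    have h2 := hF.apply_projection hr hE hC hS heC he hF0 f
    have h3 : F g = 0 := by rw [hg, map_sub, h1, h2, sub_self]
    rw [← posPart_sub_negPart g, map_sub, hF.self, hF0 _ (perp_posPart_negPart g).symm,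
      sub_zero] at h3
    by_contra hne
    exact (Real.rpow_pos_of_pos (norm_pos_iff.2 hne) r).ne' h3
  refine LinearMap.ext fun f => Subtype.ext ?_
  have h1 := key T S hT hS f
  have h2 := key S T hS hT f
  rw [posPart_eq_zero, sub_nonpos] at h1 h2
  exact le_antisymm h1 h2

end

/-! ### Integrals over measure subspaces -/

section Trim

variable {β : Type*} {m m0 : MeasurableSpace β} (hm : m ≤ m0) (κ : Measure[m0] β) {g : β → ℝ}
  {A : Set β}

lemma setIntegral_trim_of_stronglyMeasurable (hg : StronglyMeasurable[m] g)
    (hA : MeasurableSet[m] A) : ∫ y in A, g y ∂(κ.trim hm) = ∫ y in A, g y ∂κ := by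
  rw [restrict_trim hm κ hA, ← integral_trim hm hg]

end Trim

section Subtype

variable {X : Type*} [MeasurableSpace X] {μ : Measure X} {Y : Set X} {g : Y → ℝ} {A : Set Y}

lemma setIntegral_image_extend (hY : MeasurableSet Y) :
    ∫ x in Subtype.val '' A, Function.extend Subtype.val g (0 : X → ℝ) x ∂μ =
      ∫ y in A, g y ∂(μ.comap Subtype.val) := by
  have h1 : (μ.restrict Y).restrict (Subtype.val '' A) = μ.restrict (Subtype.val '' A) :=
    Measure.restrict_restrict_of_subset (by simp)
  rw [← h1, ← map_comap_subtype_coe hY, (MeasurableEmbedding.subtype_coe hY).setIntegral_map,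
    Set.preimage_image_eq _ Subtype.val_injective]
  simp_rw [Subtype.val_injective.extend_apply]

end Subtype

section Subspace

variable {X : Type*} [U : MeasurableSpace X] {μ : Measure X} {Y : Set X} {V : MeasurableSpace Y}
  {ν : Measure[V] Y} {p : ℝ≥0∞}

lemma setIntegral_extend (h : IsMeasureSubspace μ Y ν) {g : Y → ℝ} (hg : StronglyMeasurable[V] g)
    {A : Set Y} (hA : MeasurableSet[V] A) :
    ∫ x in Subtype.val '' A, Function.extend Subtype.val g (0 : X → ℝ) x ∂μ =
      ∫ y in A, g y ∂ν := by
  rw [setIntegral_image_extend h.measurableSet,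
    ← setIntegral_trim_of_stronglyMeasurable h.le_subtype _ hg hA, h.trim_comap]

lemma ae_extension_of_ae (h : IsMeasureSubspace μ Y ν) {P : Y → Prop} (hP : ∀ᵐ y ∂ν, P y) :
    ∀ᵐ x ∂μ, ∀ y : Y, (y : X) = x → P y := by
  obtain ⟨s, hs, hsm, hs0⟩ := exists_measurable_superset_of_null hP
  have h1 : μ (Subtype.val '' s) = 0 := by rw [← h.measure_eq s hsm, hs0]
  filter_upwards [measure_eq_zero_iff_ae_notMem.1 h1] with x hx y hy
  by_contra hPy
  exact hx ⟨y, hs hPy, hy⟩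

/-- Measurability in V matters: V may be coarser than the σ-algebra induced by U, and a μ-null set
need not lie in a ν-null member of V. -/
lemma ae_of_ae_extension (h : IsMeasureSubspace μ Y ν) {P : Y → Prop}
    (hm : MeasurableSet[V] {y | P y}) (hP : ∀ᵐ x ∂μ, ∀ y : Y, (y : X) = x → P y) :
    ∀ᵐ y ∂ν, P y := by
  have h1 : ν {y | P y}ᶜ = 0 := by
    rw [h.measure_eq _ hm.compl]
    refine measure_mono_null ?_ hP
    rintro _ ⟨y, hy, rfl⟩ hall
    exact hy (hall y rfl)
  exact h1

lemma inclLp_ae (h : IsMeasureSubspace μ Y ν) (g : Lp ℝ p ν) :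
    (h.inclLp g : X → ℝ) =ᵐ[μ] Function.extend Subtype.val (g : Y → ℝ) 0 :=
  MemLp.coeFn_toLp _

lemma setIntegral_inclLp (h : IsMeasureSubspace μ Y ν) (g : Lp ℝ p ν) {A : Set Y}
    (hA : MeasurableSet[V] A) :
    ∫ x in Subtype.val '' A, h.inclLp g x ∂μ = ∫ y in A, g y ∂ν := by
  rw [← setIntegral_extend h (Lp.stronglyMeasurable g) hA]
  exact integral_congr_ae (ae_restrict_of_ae (inclLp_ae h g))

lemma ae_abs_le_of_abs_inclLp_le (h : IsMeasureSubspace μ Y ν) {g k : Lp ℝ p ν}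
    (hle : |h.inclLp g| ≤ h.inclLp k) : ∀ᵐ y ∂ν, |g y| ≤ k y := by
  refine ae_of_ae_extension h ?_ ?_
  · exact measurableSet_le
      (continuous_abs.measurable.comp (Lp.stronglyMeasurable g).measurable)
      (Lp.stronglyMeasurable k).measurable
  · filter_upwards [(Lp.coeFn_le _ _).2 hle, Lp.coeFn_abs (h.inclLp g), inclLp_ae h g,
      inclLp_ae h k] with x hx h0 h1 h2 y hy
    subst hy
    rw [h0, h1, h2, Subtype.val_injective.extend_apply, Subtype.val_injective.extend_apply] at hx
    exact hx

lemma inclLp_indicator_ae (h : IsMeasureSubspace μ Y ν) {A : Set Y} (hA : MeasurableSet[V] A)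
    (hνA : ν A ≠ ∞) : (h.inclLp (indicatorConstLp p hA hνA (1 : ℝ)) : X → ℝ) =ᵐ[μ]
      (Subtype.val '' A).indicator fun _ => (1 : ℝ) := by
  filter_upwards [inclLp_ae h (indicatorConstLp p hA hνA (1 : ℝ)),
    ae_extension_of_ae h (indicatorConstLp_coeFn (p := p) (hs := hA) (hμs := hνA) (c := (1 : ℝ)))]
    with x h1 h2
  rw [h1]
  by_cases hx : ∃ y : Y, (y : X) = x
  · obtain ⟨y, rfl⟩ := hx
    rw [Subtype.val_injective.extend_apply, h2 y rfl]
    by_cases hy : y ∈ A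
    · rw [Set.indicator_of_mem hy, Set.indicator_of_mem (Set.mem_image_of_mem _ hy)]
    · rw [Set.indicator_of_notMem hy, Set.indicator_of_notMem]
      rwa [Subtype.val_injective.mem_set_image]
  · rw [Function.extend_apply' _ _ _ hx, Set.indicator_of_notMem]
    · rfl
    · rintro ⟨y, -, hy⟩
      exact hx ⟨y, hy⟩

lemma norm_Lp_rpow (hp0 : p ≠ 0) (hp : p ≠ ∞) (f : Lp ℝ p μ) :
    ‖f‖ ^ p.toReal = ∫ x, |f x| ^ p.toReal ∂μ := by
  have hr : p.toReal ≠ 0 := (ENNReal.toReal_pos hp0 hp).ne'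
  have h0 : 0 ≤ ∫ x, ‖f x‖ ^ p.toReal ∂μ := integral_nonneg fun x => by positivity
  rw [Lp.norm_def, (Lp.memLp f).eLpNorm_eq_integral_rpow_norm hp0 hp,
    ENNReal.toReal_ofReal (by positivity), Real.rpow_inv_rpow h0 hr]
  rfl

/-- Integration over a set of finite measure, as a functional supporting the norm of `L_p` at the
indicator function. -/
lemma isSupporting_setIntegral [hp1 : Fact (1 ≤ p)] (hp : p ≠ ∞) {A : Set X} (hA : MeasurableSet A)
    (hμA : μ A ≠ ∞) {e : Lp ℝ p μ} (he : (e : X → ℝ) =ᵐ[μ] A.indicator fun _ => (1 : ℝ)) :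
    ∃ F : Lp ℝ p μ →ₗ[ℝ] ℝ, (∀ f : Lp ℝ p μ, F f = ∫ x in A, f x ∂μ) ∧
      IsSupporting p.toReal F e ∧ ∀ f, Perp f e → F f = 0 := by
  have hp0 : p ≠ 0 := (zero_lt_one.trans_le hp1.out).ne'
  have hr : 1 ≤ p.toReal := by
    rw [← ENNReal.toReal_one]
    exact ENNReal.toReal_mono hp hp1.out
  have hr0 : p.toReal ≠ 0 := by linarith
  have hint : ∀ f : Lp ℝ p μ, IntegrableOn f A μ := fun f =>
    integrableOn_Lp_of_measure_ne_top f hp1.out hμA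
  let F : Lp ℝ p μ →ₗ[ℝ] ℝ :=
    { toFun := fun f => ∫ x in A, f x ∂μ
      map_add' := fun f g => by
        rw [← integral_add (hint f) (hint g)]
        exact integral_congr_ae (ae_restrict_of_ae (Lp.coeFn_add f g))
      map_smul' := fun t f => by
        rw [RingHom.id_apply, ← integral_smul]
        exact integral_congr_ae (ae_restrict_of_ae (Lp.coeFn_smul t f)) }
  have hm : ‖e‖ ^ p.toReal = μ.real A := by
    rw [norm_Lp_rpow hp0 hp]
    have : (fun x => |e x| ^ p.toReal) =ᵐ[μ] A.indicator fun _ => (1 : ℝ) := by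
      filter_upwards [he] with x hx
      rw [hx]
      by_cases hxA : x ∈ A
      · simp [hxA]
      · simp [hxA, Real.zero_rpow hr0]
    rw [integral_congr_ae this, integral_indicator hA]
    simp
  refine ⟨F, fun f => rfl, ⟨fun f => ?_, ?_⟩, fun f hf => ?_⟩
  · have hfp : Integrable (fun x => |f x| ^ p.toReal) μ :=
      (Lp.memLp f).integrable_norm_rpow hp0 hp
    have hconst : IntegrableOn (fun _ => p.toReal - 1) A μ :=
      integrableOn_const hμA
    rw [hm, norm_Lp_rpow hp0 hp]
    calc p.toReal * F f = ∫ x in A, p.toReal * f x ∂μ := (integral_const_mul _ _).symm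
      _ ≤ ∫ x in A, ((p.toReal - 1) + |f x| ^ p.toReal) ∂μ := by
        refine integral_mono ((hint f).const_mul _) (hconst.add hfp.integrableOn) fun x => ?_
        -- The scalar inequality at 1, the value of e on A, is integrated over A.
        have h1 := mul_rpow_sub_one_mul_le hr one_pos (abs_nonneg (f x))
        simp only [Real.one_rpow, one_mul, mul_one] at h1
        have h2 : p.toReal * f x ≤ p.toReal * |f x| := by
          gcongr
          exact le_abs_self _
        exact h2.trans h1
      _ = (p.toReal - 1) * μ.real A + ∫ x in A, |f x| ^ p.toReal ∂μ := by
        rw [integral_add hconst hfp.integrableOn, setIntegral_const, smul_eq_mul, mul_comm]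
      _ ≤ _ := by
        exact (add_le_add_iff_left _).2
          (setIntegral_le_integral hfp (.of_forall fun x => by positivity))
  · rw [hm]
    change ∫ x in A, e x ∂μ = _
    rw [integral_congr_ae (ae_restrict_of_ae he), setIntegral_indicator hA, Set.inter_self,
      setIntegral_const, smul_eq_mul, mul_one]
  · refine setIntegral_eq_zero_of_ae_eq_zero ?_
    have hf' : |f| ⊓ |e| = 0 := hf
    filter_upwards [he, Lp.coeFn_inf |f| |e|, Lp.coeFn_abs f, Lp.coeFn_abs e,
      Lp.coeFn_zero ℝ p μ] with x h1 h2 h3 h4 h5 hx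
    rw [hf', h5, Pi.inf_apply, h3, h4, h1, Set.indicator_of_mem hx, abs_one] at h2
    rcases min_choice |f x| 1 with h | h
    · have h6 : |f x| = 0 := h.symm.trans h2.symm
      exact abs_eq_zero.1 h6
    · have : (1 : ℝ) = 0 := h.symm.trans h2.symm
      norm_num at this

end Subspace

/-! ### Conditional expectations -/

section CondExp

variable {X : Type*} [U : MeasurableSpace X] {μ : Measure X} {Y : Set X} {V : MeasurableSpace Y}
  {ν : Measure[V] Y} {p : ℝ≥0∞}

/-- Two conditional expectations of the same function agree. -/
lemma isCondExpLp_unique [hp1 : Fact (1 ≤ p)] (hp : p ≠ ∞) (h : IsMeasureSubspace μ Y ν)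
    {f : Lp ℝ p μ} {g k : Lp ℝ p ν} (hg : IsCondExpLp f g) (hk : IsCondExpLp f k) : g = k := by
  have hp0 : p ≠ 0 := (zero_lt_one.trans_le hp1.out).ne'
  refine Lp.ext (Lp.ae_eq_of_forall_setIntegral_eq g k hp0 hp
    (fun s _ hs => integrableOn_Lp_of_measure_ne_top g hp1.out hs.ne)
    (fun s _ hs => integrableOn_Lp_of_measure_ne_top k hp1.out hs.ne) fun s hsm hs => ?_)
  have hint : IntegrableOn (f : X → ℝ) (Subtype.val '' s) μ :=
    integrableOn_Lp_of_measure_ne_top f hp1.out (by rw [← h.measure_eq s hsm]; exact hs.ne)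
  rw [(hg s hsm hint).2, (hk s hsm hint).2]

/-- A subset of `Y` that is null in every set of finite measure of the subspace is null. -/
lemma measure_eq_zero_of_forall_inter (h : IsMeasureSubspace μ Y ν) {Z : Set X}
    (hZ : MeasurableSet Z) (hZY : Z ⊆ Y)
    (hnull : ∀ S : Set Y, MeasurableSet[V] S → ν S < ∞ → μ (Z ∩ Subtype.val '' S) = 0) :
    μ Z = 0 := by
  obtain ⟨P, Q, hP, hQ, hPQ⟩ := h.exists_witness
  rw [hP.measure_eq Z hZ, ENNReal.tsum_eq_zero]
  rintro ⟨S, hS⟩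
  -- The pieces of Q cover Y, so a piece of P that meets Z is the image of one of them.
  by_cases hSZ : (Z ∩ S).Nonempty
  · obtain ⟨x, hxZ, hxS⟩ := hSZ
    obtain ⟨S', ⟨hS'Q, hxS'⟩, -⟩ := hQ.isPartition.2 ⟨x, hZY hxZ⟩
    have hx' : x ∈ Subtype.val '' S' := ⟨_, hxS', rfl⟩
    have : S = Subtype.val '' S' :=
      (hP.isPartition.2 x).unique ⟨hS, hxS⟩ ⟨hPQ S' hS'Q, hx'⟩
    subst this
    exact hnull S' (hQ.measurableSet S' hS'Q) (hQ.measure_lt_top S' hS'Q)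
  · rw [Set.not_nonempty_iff_eq_empty.1 hSZ, measure_empty]

/-- If `g` has the integrals of `f` over all sets of finite measure, and `G` dominating `g` has
those of `|f|`, then `g` is the conditional expectation of `f`. -/
lemma isCondExpLp_of_finite [hp1 : Fact (1 ≤ p)] (hp : p ≠ ∞) (h : IsMeasureSubspace μ Y ν)
    {f : Lp ℝ p μ} {g G : Lp ℝ p ν} (hgG : ∀ᵐ y ∂ν, |g y| ≤ G y)
    (hg : ∀ A : Set Y, MeasurableSet[V] A → ν A < ∞ →
      ∫ y in A, g y ∂ν = ∫ x in Subtype.val '' A, f x ∂μ)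
    (hG : ∀ A : Set Y, MeasurableSet[V] A → ν A < ∞ →
      ∫ y in A, G y ∂ν = ∫ x in Subtype.val '' A, |f x| ∂μ) : IsCondExpLp f g := by
  have hp0 : p ≠ 0 := (zero_lt_one.trans_le hp1.out).ne'
  intro A hA hfA
  have hGm : Measurable[V] (G : Y → ℝ) := (Lp.stronglyMeasurable G).measurable
  have hfm : Measurable (f : X → ℝ) := (Lp.stronglyMeasurable f).measurable
  have hG0 : ∀ᵐ y ∂ν, 0 ≤ G y := hgG.mono fun y hy => (abs_nonneg _).trans hy
  have hGint : ∀ S : Set Y, ν S < ∞ → IntegrableOn (G : Y → ℝ) S ν := fun S hS =>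
    integrableOn_Lp_of_measure_ne_top G hp1.out hS.ne
  have hfint : ∀ S : Set Y, MeasurableSet[V] S → ν S < ∞ →
      IntegrableOn (f : X → ℝ) (Subtype.val '' S) μ := fun S hSm hS =>
    integrableOn_Lp_of_measure_ne_top f hp1.out (by rw [← h.measure_eq S hSm]; exact hS.ne)
  -- Level sets of G ∈ L_p have finite measure and exhaust the part of A where G > 0.
  set B : ℕ → Set Y := fun n => A ∩ {y | 1 / ((n : ℝ) + 1) ≤ G y} with hB
  have hBm : ∀ n, MeasurableSet[V] (B n) := fun n => hA.inter (measurableSet_le measurable_const hGm)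
  have hBfin : ∀ n, ν (B n) < ∞ := fun n => by
    have hε : (0 : ℝ) < 1 / ((n : ℝ) + 1) := by positivity
    refine lt_of_le_of_lt (measure_mono ?_) ((Lp.memLp G).meas_ge_lt_top hp0 hp
      (ε := ⟨1 / ((n : ℝ) + 1), hε.le⟩) (fun h => hε.ne' (congrArg NNReal.toReal h)))
    rintro y ⟨-, hy⟩
    change 1 / ((n : ℝ) + 1) ≤ ‖G y‖
    exact le_trans hy (le_abs_self _)
  have hBmono : Monotone B := fun n k hnk => by
    refine Set.inter_subset_inter_right _ fun y (hy : 1 / ((n : ℝ) + 1) ≤ G y) => ?_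
    exact (one_div_le_one_div_of_le (by positivity) (by gcongr)).trans hy
  set D : Set Y := ⋃ n, B n with hD
  have hDm : MeasurableSet[V] D := MeasurableSet.iUnion hBm
  have hDA : D ⊆ A := Set.iUnion_subset fun n => Set.inter_subset_left
  have hdiff : ∀ y ∈ A \ D, G y ≤ 0 := by
    rintro y ⟨hyA, hyD⟩
    by_contra! hpos
    obtain ⟨n, hn⟩ := exists_nat_one_div_lt hpos
    exact hyD (Set.mem_iUnion.2 ⟨n, hyA, hn.le⟩)
  have hgdiff : ∀ᵐ y ∂ν, y ∈ A \ D → g y = 0 := hgG.mono fun y hy hyAD =>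
    abs_eq_zero.1 (le_antisymm (hy.trans (hdiff y hyAD)) (abs_nonneg _))
  -- Where G ≤ 0, the integral of |f| over every V-set of finite measure is at most 0;
  -- decomposability assembles these null sets.
  have hfdiff : ∀ᵐ x ∂μ, x ∈ Subtype.val '' A \ Subtype.val '' D → f x = 0 := by
    have hnull : μ (Subtype.val '' (A \ D) ∩ {x | f x ≠ 0}) = 0 := by
      refine measure_eq_zero_of_forall_inter h
        ((h.measurableSet_image _ (hA.diff hDm)).inter (hfm (measurableSet_singleton 0).compl))
        (fun x hx => by obtain ⟨⟨y, -, rfl⟩, -⟩ := hx; exact y.2) fun S hSm hS => ?_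
      have hSm' : MeasurableSet[V] ((A \ D) ∩ S) := (hA.diff hDm).inter hSm
      have hS' : ν ((A \ D) ∩ S) < ∞ := (measure_mono Set.inter_subset_right).trans_lt hS
      have h1 : ∫ x in Subtype.val '' ((A \ D) ∩ S), |f x| ∂μ ≤ 0 := by
        rw [← hG _ hSm' hS']
        exact setIntegral_nonpos hSm' fun y hy => hdiff y hy.1
      have h2 : ∀ᵐ x ∂μ.restrict (Subtype.val '' ((A \ D) ∩ S)), |f x| = 0 :=
        (integral_eq_zero_iff_of_nonneg (fun x => abs_nonneg (f x))
          (hfint _ hSm' hS').abs).1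
          (le_antisymm h1 (integral_nonneg fun x => abs_nonneg (f x)))
      rw [ae_restrict_iff' (h.measurableSet_image _ hSm')] at h2
      refine measure_mono_null ?_ h2
      rintro x ⟨⟨⟨y, hy, rfl⟩, hfx⟩, ⟨z, hz, hzy⟩⟩ hall
      obtain rfl := Subtype.val_injective hzy
      exact hfx (abs_eq_zero.1 (hall ⟨z, ⟨hy, hz⟩, rfl⟩))
    filter_upwards [measure_eq_zero_iff_ae_notMem.1 hnull] with x hx hxAD
    rw [← Set.image_sdiff Subtype.val_injective] at hxAD
    by_contra hne
    exact hx ⟨hxAD, hne⟩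
  -- Monotone convergence: the integral of G over each B n is that of |f|, bounded by the integral
  -- of |f| over A.
  have hGD : IntegrableOn (G : Y → ℝ) D ν := by
    refine ⟨(Lp.stronglyMeasurable G).aestronglyMeasurable, ?_⟩
    rw [hasFiniteIntegral_iff_ofReal (ae_restrict_of_ae hG0), hD,
      setLIntegral_iUnion_of_directed _ (hBmono.directed_le)]
    refine lt_of_le_of_lt (iSup_le fun n => ?_)
      (ENNReal.ofReal_lt_top (r := ∫ x in Subtype.val '' A, |f x| ∂μ))
    rw [← ofReal_integral_eq_lintegral_ofReal (hGint _ (hBfin n)) (ae_restrict_of_ae hG0),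
      hG _ (hBm n) (hBfin n)]
    refine ENNReal.ofReal_le_ofReal (setIntegral_mono_set hfA.abs
      (.of_forall fun x => abs_nonneg (f x)) ?_)
    exact (Set.image_mono Set.inter_subset_left).eventuallyLE
  have hgD : IntegrableOn (g : Y → ℝ) D ν :=
    Integrable.mono' hGD (Lp.stronglyMeasurable g).aestronglyMeasurable
      (ae_restrict_of_ae hgG)
  refine ⟨hgD.of_ae_sdiff_eq_zero hA.nullMeasurableSet hgdiff, ?_⟩
  rw [setIntegral_eq_of_subset_of_ae_sdiff_eq_zero hA.nullMeasurableSet hDA hgdiff,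
    setIntegral_eq_of_subset_of_ae_sdiff_eq_zero (h.measurableSet_image A hA).nullMeasurableSet
      (Set.image_mono hDA) hfdiff]
  have hDimage : (Subtype.val '' D : Set X) = ⋃ n, Subtype.val '' B n := Set.image_iUnion
  have hlim1 := tendsto_setIntegral_of_monotone hBm hBmono hgD
  have hlim2 := tendsto_setIntegral_of_monotone (μ := μ) (f := (f : X → ℝ))
    (fun n => h.measurableSet_image _ (hBm n))
    (fun n k hnk => Set.image_mono (hBmono hnk))
    (by rw [← hDimage]; exact hfA.mono_set (Set.image_mono hDA))
  rw [← hDimage] at hlim2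
  refine tendsto_nhds_unique hlim1 (hlim2.congr fun n => ?_)
  exact (hg _ (hBm n) (hBfin n)).symm

end CondExp

/-! ### The projection in a representation of E as an L_p-space -/

section Representation

variable {E : Type*} [NormedAddCommGroup E] [NormedSpace ℝ E] [Lattice E] [IsOrderedAddMonoid E]
  [IsOrderedModule ℝ E] [HasSolidNorm E] [CompleteSpace E] {C : Submodule ℝ E} {p : ℝ≥0∞}
  [hp1 : Fact (1 ≤ p)] {X : Type*} [U : MeasurableSpace X] {μ : Measure X} {Y : Set X}
  {V : MeasurableSpace Y} {ν : Measure[V] Y}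

/-- A contractive positive projection preserves integrals over sets of finite measure. -/
lemma setIntegral_projection_eq (hp : p ≠ ∞) (hE : DisjointlyAdditive p.toReal E)
    (hC : IsClosedSublattice C) {T : E →ₗ[ℝ] C} (hT : IsContractivePositiveProjection C T)
    (h : IsMeasureSubspace μ Y ν) (Φ : Lp ℝ p μ ≃ₗᵢ[ℝ] E)
    (hΦ : ∀ f₁ f₂ : Lp ℝ p μ, Φ f₁ ≤ Φ f₂ ↔ f₁ ≤ f₂)
    (hrange : Set.range (fun g : Lp ℝ p ν => Φ (h.inclLp g)) = (C : Set E)) {f : E}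
    {g : Lp ℝ p ν} (hg : Φ (h.inclLp g) = T f) {A : Set Y} (hA : MeasurableSet[V] A)
    (hνA : ν A < ∞) : ∫ y in A, g y ∂ν = ∫ x in Subtype.val '' A, Φ.symm f x ∂μ := by
  have hr : 1 ≤ p.toReal := by
    rw [← ENNReal.toReal_one]
    exact ENNReal.toReal_mono hp hp1.out
  let Ψ : Lp ℝ p μ ≃o E := ⟨Φ.toEquiv, fun {a b} => hΦ a b⟩
  have hΨ : ∀ a, Ψ a = Φ a := fun a => rfl
  set e₁ : Lp ℝ p μ := h.inclLp (indicatorConstLp p hA hνA.ne (1 : ℝ)) with he₁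
  have he₁ae := inclLp_indicator_ae (p := p) h hA hνA.ne
  have hAm := h.measurableSet_image A hA
  obtain ⟨F, hF, hFs, hF0⟩ := isSupporting_setIntegral hp hAm
    (by rw [← h.measure_eq A hA]; exact hνA.ne) he₁ae
  have he₁0 : 0 ≤ e₁ := by
    rw [← Lp.coeFn_nonneg]
    filter_upwards [he₁ae] with x hx
    rw [hx]
    exact Set.indicator_nonneg (fun _ _ => zero_le_one) x
  have heC : Φ e₁ ∈ C := by
    have : Φ e₁ ∈ Set.range (fun g : Lp ℝ p ν => Φ (h.inclLp g)) := ⟨_, rfl⟩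
    rwa [hrange] at this
  have he0 : 0 ≤ Φ e₁ := by
    have := (hΦ 0 e₁).2 he₁0
    rwa [map_zero] at this
  let F' : E →ₗ[ℝ] ℝ := F ∘ₗ (Φ.symm.toLinearEquiv : E →ₗ[ℝ] Lp ℝ p μ)
  have hF' : ∀ k, F' k = F (Φ.symm k) := fun k => rfl
  -- The support property involves only norms, so it passes through the isometry.
  have hF's : IsSupporting p.toReal F' (Φ e₁) := by
    refine ⟨fun k => ?_, ?_⟩
    · rw [hF', Φ.norm_map, ← Φ.symm.norm_map k]
      exact hFs.young _
    · rw [hF', Φ.symm_apply_apply, hFs.self, Φ.norm_map]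
  have habs : ∀ a : Lp ℝ p μ, Φ |a| = |Φ a| := fun a => by
    change Ψ (a ⊔ -a) = Φ a ⊔ -(Φ a)
    rw [Ψ.map_sup, hΨ, hΨ, map_neg]
  have hF'0 : ∀ k, Perp k (Φ e₁) → F' k = 0 := fun k hk => by
    rw [hF']
    refine hF0 _ ?_
    have h1 : Φ (|Φ.symm k| ⊓ |e₁|) = 0 := by
      have h2 : Ψ (|Φ.symm k| ⊓ |e₁|) = Ψ |Φ.symm k| ⊓ Ψ |e₁| := Ψ.map_inf _ _
      rw [hΨ, hΨ, hΨ, habs, habs, Φ.apply_symm_apply] at h2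
      rw [h2]
      exact hk
    exact (map_eq_zero_iff Φ Φ.injective).1 h1
  have key := hF's.apply_projection hr hE hC hT heC he0 hF'0 f
  rw [← hg, hF', hF', Φ.symm_apply_apply, hF, hF, setIntegral_inclLp h g hA] at key
  exact key

/-- The dominating function G represents T|f|: positivity gives |Tf| ≤ T|f|, and its integrals over
sets of finite measure are those of |Φ⁻¹ f|. -/
lemma isCondExpLp_projection (hp : p ≠ ∞) (hE : DisjointlyAdditive p.toReal E)
    (hC : IsClosedSublattice C) {T : E →ₗ[ℝ] C} (hT : IsContractivePositiveProjection C T)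
    (h : IsMeasureSubspace μ Y ν) (Φ : Lp ℝ p μ ≃ₗᵢ[ℝ] E)
    (hΦ : ∀ f₁ f₂ : Lp ℝ p μ, Φ f₁ ≤ Φ f₂ ↔ f₁ ≤ f₂)
    (hrange : Set.range (fun g : Lp ℝ p ν => Φ (h.inclLp g)) = (C : Set E)) {f : E}
    {g : Lp ℝ p ν} (hg : Φ (h.inclLp g) = T f) : IsCondExpLp (Φ.symm f) g := by
  let Ψ : Lp ℝ p μ ≃o E := ⟨Φ.toEquiv, fun {a b} => hΦ a b⟩
  have hΨ : ∀ a, Ψ a = Φ a := fun a => rfl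
  have habs : ∀ a : Lp ℝ p μ, Φ |a| = |Φ a| := fun a => by
    change Ψ (a ⊔ -a) = Φ a ⊔ -(Φ a)
    rw [Ψ.map_sup, hΨ, hΨ, map_neg]
  obtain ⟨G, hG⟩ : ∃ G : Lp ℝ p ν, Φ (h.inclLp G) = T |f| := by
    have : (T |f| : E) ∈ Set.range (fun g : Lp ℝ p ν => Φ (h.inclLp g)) := by
      rw [hrange]; exact (T |f|).2
    exact this
  refine isCondExpLp_of_finite hp h (G := G) ?_
    (fun A hA hνA => setIntegral_projection_eq hp hE hC hT h Φ hΦ hrange hg hA hνA)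
    (fun A hA hνA => ?_)
  · refine ae_abs_le_of_abs_inclLp_le h ((hΦ _ _).1 ?_)
    rw [habs, hg, hG]
    have h1 := hT.positive _ (sub_nonneg.2 (le_abs_self f))
    have h2 := hT.positive _ (sub_nonneg.2 (neg_le_abs f))
    rw [map_sub, Submodule.coe_sub, sub_nonneg] at h1 h2
    rw [map_neg, Submodule.coe_neg] at h2
    exact abs_le'.2 ⟨h1, h2⟩
  · rw [setIntegral_projection_eq hp hE hC hT h Φ hΦ hrange hG hA hνA]
    have h1 : Φ.symm |f| = |Φ.symm f| := by
      apply Φ.injective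
      rw [habs, Φ.apply_symm_apply, Φ.apply_symm_apply]
    rw [h1]
    exact integral_congr_ae (ae_restrict_of_ae (Lp.coeFn_abs _))

end Representation

end AbstractLp

theorem proposition2p7 (p : ℝ≥0∞) [Fact (1 ≤ p)] (hp : p ≠ ∞)
    (E : Type*) [NormedAddCommGroup E] [NormedSpace ℝ E] [CompleteSpace E]
    [Lattice E] [IsOrderedAddMonoid E] [IsOrderedModule ℝ E] [HasSolidNorm E]
    (hE : IsAbstractLp p E) (C : Submodule ℝ E) (hC : IsClosedSublattice C) :
    (∃! T : E →ₗ[ℝ] C, IsContractivePositiveProjection C T) ∧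
    ∀ T : E →ₗ[ℝ] C, IsContractivePositiveProjection C T →
      ∀ (X : Type*) [MeasurableSpace X] (μ : Measure X) (Y : Set X) (V : MeasurableSpace Y)
        (ν : Measure[V] Y) (h : IsMeasureSubspace μ Y ν)
        (Φ : Lp ℝ p μ ≃ₗᵢ[ℝ] E), (∀ f₁ f₂ : Lp ℝ p μ, Φ f₁ ≤ Φ f₂ ↔ f₁ ≤ f₂) →
        Set.range (fun g : Lp ℝ p ν => Φ (h.inclLp g)) = (C : Set E) →
        ∀ f : E, (∃! g : Lp ℝ p ν, IsCondExpLp (Φ.symm f) g) ∧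
          ∀ g : Lp ℝ p ν, IsCondExpLp (Φ.symm f) g → (T f : E) = Φ (h.inclLp g) := by
  have hr : 1 ≤ p.toReal := by
    rw [← ENNReal.toReal_one]
    exact ENNReal.toReal_mono hp Fact.out
  have hE' : AbstractLp.DisjointlyAdditive p.toReal E := hE
  obtain ⟨T, hT⟩ := AbstractLp.exists_contractivePositiveProjection hr hE' hC
  refine ⟨⟨T, hT, fun S hS =>
    AbstractLp.contractivePositiveProjection_unique hr hE' hC hS hT⟩, ?_⟩
  intro T hT X _ μ Y V ν h Φ hΦ hrange f
  obtain ⟨g, hg⟩ : ∃ g : Lp ℝ p ν, Φ (h.inclLp g) = T f := by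
    have : (T f : E) ∈ Set.range (fun g : Lp ℝ p ν => Φ (h.inclLp g)) := by
      rw [hrange]; exact (T f).2
    exact this
  have hgc := AbstractLp.isCondExpLp_projection hp hE' hC hT h Φ hΦ hrange hg
  refine ⟨⟨g, hgc, fun k hk => AbstractLp.isCondExpLp_unique hp h hk hgc⟩, fun k hk => ?_⟩
  rw [AbstractLp.isCondExpLp_unique hp h hk hgc, hg]
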